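/- **Conventions.** Let $\mathbb T^3=(\mathbb R/\mathbb Z)^3$. An $SU(3)$-structure on a 6-manifold $M$ is a triple $(g,J,\psi)$ of a Riemannian metric, a compatible almost complex structure and a $(3,0)$-form $\psi=\psi^++i\psi^-$ with $\psi\wedge\bar\psi=-8i\,\mathrm{vol}_g$; put $\omega=g(J\cdot,\cdot)$, so that $\mathrm{vol}_g=\frac16\omega^3$. It is *strict nearly Kähler* (strict NK) if $d\omega=3\psi^+$ and $d\psi^-=-2\,\omega\wedge\omega$. An infinitesimal automorphism is a vector field $\zeta$ with $L_\zeta g=0$, $L_\zeta J=0$, $L_\zeta\omega=0$, $L_\zeta\psi^\pm=0$. **Theorem.** Let $U\subset\mathbb R^3$ be open and let $\varphi\in C^\infty(U)$ satisfy $$\det\mathrm{Hess}(\varphi)=\tfrac83\varphi-\tfrac{11}3\partial_r\varphi+\partial_r^2\varphi,\qquad \partial_r f=\sum_i y_i\,\partial f/\partial y_i .$$ Put $C=\mathrm{Hess}(\varphi)$, $\mu=\begin{pmatrix}0&y_3&-y_2\\-y_3&0&y_1\\y_2&-y_1&0\end{pmatrix}$, $D=\begin{pmatrix}C&-\mu\\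 \mu&C\end{pmatrix}$ and $$U_0=\{y\in U:\ \varphi-\partial_r\varphi>0\ \text{and } D \text{ is positive definite}\}.$$ On $U_0$ define $\varepsilon>0$ by $\varepsilon^2=\frac83(\varphi-\partial_r\varphi)$, 1-forms $\gamma^i$ by $dy_i=-3\varepsilon\gamma^i$, $c^i=\sum_jC_{ij}\gamma^j$, $\eta=y_1\gamma^2\wedge\gamma^3+y_2\gamma^3\wedge\gamma^1+y_3\gamma^1\wedge\gamma^2$, and $\tau_i=\varepsilon^{-1}(c^j\wedge c^k-y_i\eta)$ for $(i,j,k)$ a cyclic permutation of $(1,2,3)$. 1. $U_0$ is open, and the $\tau_i$ are smooth closed 2-forms on $U_0$. Consequently, on every open $W\subset U_0$ that is convex or has $H^2(W;\mathbb R)=0$ there are smooth 1-forms $\sigma_i$ with $d\sigma_i=4\tau_i$. In particular they exist near each point of $U_0$, and on all of $U_0$ if $H^2(U_0;\mathbb R)=0$. 2. Let $W\subset U_0$ be any open subset with smooth 1-forms $\sigma_i$ on $W$ such that $d\sigma_i=4\tau_i$ (for instance $W=U_0$, if such forms exist there). Let $x_1,x_2,x_3$ be the angular coordinates of $\mathbb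 T^3$ and $\theta^i=dx_i+\sigma_i$ on $W\times\mathbb T^3$. Then there is a unique $SU(3)$-structure $(g,J,\psi)$ on $W\times\mathbb T^3$ with $$\omega=\sum_{(i,j,k)}y_k(\theta^i\wedge\theta^j+\gamma^i\wedge\gamma^j)+\sum_i\theta^i\wedge c^i,$$ $$\psi^+=\varepsilon\Big(\gamma^1\wedge\gamma^2\wedge\gamma^3-\sum_{(i,j,k)}\theta^i\wedge\theta^j\wedge\gamma^k\Big),\qquad \psi^-=\varepsilon\Big(\theta^1\wedge\theta^2\wedge\theta^3-\sum_{(i,j,k)}\gamma^i\wedge\gamma^j\wedge\theta^k\Big)$$ (sums over cyclic permutations of $(1,2,3)$). It is strict nearly Kähler and is preserved by the standard $\mathbb T^3$-action. The generators $\zeta_i=\partial/\partial x_i$ are three linearly independent commuting infinitesimal automorphisms, and $g(\zeta_i,\zeta_j)=\mathrm{Hess}(\varphi)_{ij}$. 3. If $W\subset U_0$ is open and convex, the structure on $W\times\mathbb T^3$ does not depend on the choice of the $\sigma_i$ up to isomorphism: for two choices there is a smooth $h:W\to\mathbb R^3$ such that the $\mathbb T^3$-equivariant diffeomorphism $(y,t)\mapsto(y,t+[h(y)])$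 pulls the forms $\omega,\psi^\pm$ of one choice back to those of the other. -/

import Mathlib

open Set
open scoped ContDiff Matrix

noncomputable section

/-! ### The manifold `W × T³` and tensor fields on it -/

/-- `ℝ³`, as a manifold with its standard coordinates. -/
abbrev R3 : Type := Fin 3 → ℝ

/-- The torus `T³ = (ℝ/ℤ)³`. -/
abbrev Torus3 : Type := Fin 3 → UnitAddCircle

/-- Tangent vectors of `ℝ³ × T³`.  The tangent bundle of `ℝ³ × T³` is trivialised by the coordinate
vector fields `∂/∂y₁, ∂/∂y₂, ∂/∂y₃, ∂/∂x₁, ∂/∂x₂, ∂/∂x₃`, which are globally defined (the angular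
coordinates `xᵢ` themselves only locally); `(w, ξ)` stands for `∑ wᵢ ∂/∂yᵢ + ∑ ξᵢ ∂/∂xᵢ`.
The same type is the universal cover of `ℝ³ × T³`. -/
abbrev Tan : Type := R3 × R3

/-- The covering homomorphism `ℝ³ → T³`. -/
def torusProj (x : R3) : Torus3 := fun i => (x i : UnitAddCircle)

/-- A tensor field on `ℝ³ × T³` (a function to the corresponding space of tensors on `Tan`), read in
the coordinates `(y, x)`, i.e. pulled back to the universal cover `ℝ³ × ℝ³`. -/
def lift {F : Type*} (T : R3 × Torus3 → F) : Tan → F := fun p => T (p.1, torusProj p.2)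

/-- Smoothness over the open subset `W × T³`. -/
def SmoothOver {F : Type*} [NormedAddCommGroup F] [NormedSpace ℝ F] (W : Set R3)
    (T : R3 × Torus3 → F) : Prop :=
  ContDiffOn ℝ ∞ (lift T) (W ×ˢ univ)

/-- Differential `k`-forms on `ℝ³ × T³` with values in `A`. -/
abbrev MForm (k : ℕ) (A : Type) [NormedAddCommGroup A] [NormedSpace ℝ A] : Type :=
  R3 × Torus3 → Tan [⋀^Fin k]→L[ℝ] A

/-! ### Exterior algebra -/

/-- The exterior product of alternating forms with values in an algebra
(the signed sum over shuffles). -/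
def wedge {E A : Type*} [AddCommGroup E] [Module ℝ E] [CommRing A] [Algebra ℝ A] {k l : ℕ}
    (a : E [⋀^Fin k]→ₗ[ℝ] A) (b : E [⋀^Fin l]→ₗ[ℝ] A) : E [⋀^Fin (k + l)]→ₗ[ℝ] A :=
  ((LinearMap.mul' ℝ A).compAlternatingMap (a.domCoprod b)).domDomCongr finSumFinEquiv

/-- The exterior product `f₀ ∧ ⋯ ∧ fₖ₋₁` of covectors, `v ↦ det (fᵢ (vⱼ))`. -/
def covectorWedge {E : Type*} [NormedAddCommGroup E] [NormedSpace ℝ E] {k : ℕ}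
    (f : Fin k → E →L[ℝ] ℝ) : E [⋀^Fin k]→L[ℝ] ℝ :=
  ContinuousMultilinearMap.alternatization
    ((ContinuousMultilinearMap.mkPiAlgebra ℝ (Fin k) ℝ).compContinuousLinearMap f)

/-- A covector as an alternating `1`-form. -/
def oneForm {E : Type*} [NormedAddCommGroup E] [NormedSpace ℝ E] (f : E →L[ℝ] ℝ) :
    E [⋀^Fin 1]→L[ℝ] ℝ :=
  ContinuousAlternatingMap.ofSubsingleton ℝ E ℝ (0 : Fin 1) f

/-! ### `SU(3)`-structures and strict nearly Kähler structures on `W × T³` -/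

/-- An `SU(3)`-structure `(g, J, ψ)` on `W × T³`: a Riemannian metric, a compatible almost complex
structure and a `(3,0)`-form `ψ` with `ψ ∧ ψ̄ = -8i vol_g`, where `vol_g = ω³/6` is the volume form
of `g` and `ω = g(J·,·)`. -/
structure SU3Structure (W : Set R3) where
  g : R3 × Torus3 → Tan →L[ℝ] Tan →L[ℝ] ℝ
  J : R3 × Torus3 → Tan →L[ℝ] Tan
  omega : MForm 2 ℝ
  psi : MForm 3 ℂ
  g_smooth : SmoothOver W g
  J_smooth : SmoothOver W J
  psi_smooth : SmoothOver W psi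
  g_symm : ∀ q : R3 × Torus3, q.1 ∈ W → ∀ u v, g q u v = g q v u
  g_pos : ∀ q : R3 × Torus3, q.1 ∈ W → ∀ u, u ≠ 0 → 0 < g q u u
  J_sq : ∀ q : R3 × Torus3, q.1 ∈ W → ∀ u, J q (J q u) = -u
  J_compatible : ∀ q : R3 × Torus3, q.1 ∈ W → ∀ u v, g q (J q u) (J q v) = g q u v
  omega_eq : ∀ q : R3 × Torus3, q.1 ∈ W → ∀ u v, omega q ![u, v] = g q (J q u) v
  psi_type : ∀ q : R3 × Torus3, q.1 ∈ W → ∀ u v w,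
    psi q ![J q u, v, w] = Complex.I * psi q ![u, v, w]
  psi_normalized : ∀ q : R3 × Torus3, q.1 ∈ W → ∀ v : Fin 6 → Tan,
    wedge (psi q).toAlternatingMap
        ((Complex.conjCLE : ℂ →L[ℝ] ℂ).compContinuousAlternatingMap (psi q)).toAlternatingMap v =
      -8 * Complex.I *
        ((1 / 6 * wedge (wedge (omega q).toAlternatingMap (omega q).toAlternatingMap)
          (omega q).toAlternatingMap v : ℝ) : ℂ)

namespace SU3Structure

variable {W : Set R3}

/-- `ψ⁺ = Re ψ`. -/
def psiPlus (S : SU3Structure W) : MForm 3 ℝ :=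
  fun q => Complex.reCLM.compContinuousAlternatingMap (S.psi q)

/-- `ψ⁻ = Im ψ`. -/
def psiMinus (S : SU3Structure W) : MForm 3 ℝ :=
  fun q => Complex.imCLM.compContinuousAlternatingMap (S.psi q)

/-- Strict nearly Kähler structures: `dω = 3 ψ⁺` and `dψ⁻ = -2 ω ∧ ω` on `W × T³`. -/
def IsStrictNK (S : SU3Structure W) : Prop :=
  ∀ p : Tan, p.1 ∈ W →
    extDeriv (lift S.omega) p = (3 : ℝ) • lift S.psiPlus p ∧
    ∀ v : Fin 4 → Tan, extDeriv (lift S.psiMinus) p v =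
      -2 * wedge (lift S.omega p).toAlternatingMap (lift S.omega p).toAlternatingMap v

/-- The standard action of `T³` on `W × T³`, by translations of the second factor, preserves the
structure.  (The differential of a translation is the identity of `Tan`.) -/
def IsTorusInvariant (S : SU3Structure W) : Prop :=
  ∀ s : Torus3, ∀ y ∈ W, ∀ t : Torus3,
    S.g (y, t + s) = S.g (y, t) ∧ S.J (y, t + s) = S.J (y, t) ∧
    S.omega (y, t + s) = S.omega (y, t) ∧ S.psi (y, t + s) = S.psi (y, t)

end SU3Structure

/-! ### Lie derivatives (in the coordinates `(y, x)`) and infinitesimal automorphisms -/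

/-- The Lie derivative of a bilinear form along `X`. -/
def lieBilin (X : Tan → Tan) (g : Tan → Tan →L[ℝ] Tan →L[ℝ] ℝ) (p u v : Tan) : ℝ :=
  fderiv ℝ g p (X p) u v + g p (fderiv ℝ X p u) v + g p u (fderiv ℝ X p v)

/-- The Lie derivative of an endomorphism field along `X`. -/
def lieEndo (X : Tan → Tan) (J : Tan → Tan →L[ℝ] Tan) (p u : Tan) : Tan :=
  fderiv ℝ J p (X p) u - fderiv ℝ X p (J p u) + J p (fderiv ℝ X p u)

/-- The Lie derivative of a differential form along `X`. -/
def lieForm {k : ℕ} (X : Tan → Tan) (α : Tan → Tan [⋀^Fin k]→L[ℝ] ℝ) (p : Tan)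
    (v : Fin k → Tan) : ℝ :=
  fderiv ℝ α p (X p) v + ∑ i, α p (Function.update v i (fderiv ℝ X p (v i)))

/-- An infinitesimal automorphism of `S`: a smooth vector field on `W × T³` which is Killing,
pseudo-holomorphic, and preserves `ω` and `ψ^±`. -/
def SU3Structure.IsInfinitesimalAutomorphism {W : Set R3} (S : SU3Structure W)
    (X : R3 × Torus3 → Tan) : Prop :=
  SmoothOver W X ∧ ∀ p : Tan, p.1 ∈ W →
    (∀ u v, lieBilin (lift X) (lift S.g) p u v = 0) ∧
    (∀ u, lieEndo (lift X) (lift S.J) p u = 0) ∧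
    (∀ v, lieForm (lift X) (lift S.omega) p v = 0) ∧
    (∀ v, lieForm (lift X) (lift S.psiPlus) p v = 0) ∧
    (∀ v, lieForm (lift X) (lift S.psiMinus) p v = 0)

/-- The vector fields `ζᵢ = ∂/∂xᵢ` generating the standard `T³`-action. -/
def torusField (i : Fin 3) : R3 × Torus3 → Tan := fun _ => (0, Pi.single i 1)

/-! ### The Monge–Ampère-type equation and the data attached to a function `φ` -/

/-- `∂f/∂yᵢ`. -/
def partialD (i : Fin 3) (f : R3 → ℝ) (y : R3) : ℝ := fderiv ℝ f y (Pi.single i 1)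

/-- The Hessian matrix. -/
def hess (φ : R3 → ℝ) (y : R3) : Matrix (Fin 3) (Fin 3) ℝ :=
  Matrix.of fun i j => partialD i (partialD j φ) y

/-- The radial derivative `∂ᵣ f = ∑ yᵢ ∂f/∂yᵢ`. -/
def radialD (f : R3 → ℝ) (y : R3) : ℝ := ∑ i, y i * partialD i f y

/-- `φ` solves `det Hess φ = (8/3) φ - (11/3) ∂ᵣφ + ∂ᵣ²φ` on `U`. -/
def SolvesMA (U : Set R3) (φ : R3 → ℝ) : Prop :=
  ∀ y ∈ U, (hess φ y).det =
    8 / 3 * φ y - 11 / 3 * radialD φ y + radialD (radialD φ) y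

/-- The skew-symmetric matrix `μ`. -/
def muMatrix (y : R3) : Matrix (Fin 3) (Fin 3) ℝ :=
  !![0, y 2, -y 1; -y 2, 0, y 0; y 1, -y 0, 0]

/-- The symmetric `6 × 6` matrix `D`. -/
def bigMatrix (φ : R3 → ℝ) (y : R3) : Matrix (Fin 3 ⊕ Fin 3) (Fin 3 ⊕ Fin 3) ℝ :=
  Matrix.fromBlocks (hess φ y) (-muMatrix y) (muMatrix y) (hess φ y)

/-- The set `U₀ ⊆ U`. -/
def admissibleSet (U : Set R3) (φ : R3 → ℝ) : Set R3 :=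
  {y | y ∈ U ∧ 0 < φ y - radialD φ y ∧ (bigMatrix φ y).PosDef}

/-- `ε > 0` with `ε² = (8/3)(φ - ∂ᵣφ)`. -/
def epsFun (φ : R3 → ℝ) (y : R3) : ℝ := √(8 / 3 * (φ y - radialD φ y))

/-- The `1`-forms `γⁱ` with `dyᵢ = -3 ε γⁱ`. -/
def gammaForm (φ : R3 → ℝ) (i : Fin 3) (y : R3) : R3 →L[ℝ] ℝ :=
  (-(3 * epsFun φ y)⁻¹) • ContinuousLinearMap.proj i

/-- The `1`-forms `cⁱ = ∑ⱼ Cᵢⱼ γʲ`, with `C = Hess φ`. -/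
def cForm (φ : R3 → ℝ) (i : Fin 3) (y : R3) : R3 →L[ℝ] ℝ :=
  ∑ j, hess φ y i j • gammaForm φ j y

/-- `η = y₁ γ²∧γ³ + y₂ γ³∧γ¹ + y₃ γ¹∧γ²` (indices in `Fin 3` are cyclic). -/
def etaForm (φ : R3 → ℝ) (y : R3) : R3 [⋀^Fin 2]→L[ℝ] ℝ :=
  ∑ k : Fin 3, y k • covectorWedge ![gammaForm φ (k + 1) y, gammaForm φ (k + 2) y]

/-- `τ₁ = (c²∧c³ - y₁ η)/ε` and cyclically `τ₂`, `τ₃`. -/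
def tauForm (φ : R3 → ℝ) (i : Fin 3) (y : R3) : R3 [⋀^Fin 2]→L[ℝ] ℝ :=
  (epsFun φ y)⁻¹ • (covectorWedge ![cForm φ (i + 1) y, cForm φ (i + 2) y] - y i • etaForm φ y)

/-- Smooth `1`-forms `σ₁, σ₂, σ₃` on `W` with `dσᵢ = 4 τᵢ`. -/
def IsPotential (φ : R3 → ℝ) (W : Set R3) (σ : Fin 3 → R3 → R3 →L[ℝ] ℝ) : Prop :=
  ∀ i, ContDiffOn ℝ ∞ (σ i) W ∧
    ∀ y ∈ W, extDeriv (fun z => oneForm (σ i z)) y = (4 : ℝ) • tauForm φ i y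

/-- Every smooth closed `2`-form on the open set `W` is exact, i.e. `H²(W; ℝ) = 0`. -/
def SecondCohomologyVanishes (W : Set R3) : Prop :=
  ∀ β : R3 → R3 [⋀^Fin 2]→L[ℝ] ℝ, ContDiffOn ℝ ∞ β W → (∀ y ∈ W, extDeriv β y = 0) →
    ∃ α : R3 → R3 →L[ℝ] ℝ, ContDiffOn ℝ ∞ α W ∧
      ∀ y ∈ W, extDeriv (fun z => oneForm (α z)) y = β y

/-- The pull-back to `W × T³` of a covector on `W`. -/
def basic (a : R3 →L[ℝ] ℝ) : Tan →L[ℝ] ℝ := a.comp (ContinuousLinearMap.fst ℝ R3 R3)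

/-- The `1`-forms `θⁱ = dxᵢ + σᵢ` on `W × T³`. -/
def thetaForm (σ : Fin 3 → R3 → R3 →L[ℝ] ℝ) (i : Fin 3) (y : R3) : Tan →L[ℝ] ℝ :=
  (ContinuousLinearMap.proj i).comp (ContinuousLinearMap.snd ℝ R3 R3) + basic (σ i y)

/-- `ω = y₃ (θ¹∧θ² + γ¹∧γ²) + y₂ (θ³∧θ¹ + γ³∧γ¹) + y₁ (θ²∧θ³ + γ²∧γ³) + ∑ θⁱ∧cⁱ`. -/
def toricOmega (φ : R3 → ℝ) (σ : Fin 3 → R3 → R3 →L[ℝ] ℝ) : MForm 2 ℝ := fun q =>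
  (∑ k : Fin 3, q.1 k •
    (covectorWedge ![thetaForm σ (k + 1) q.1, thetaForm σ (k + 2) q.1] +
      covectorWedge ![basic (gammaForm φ (k + 1) q.1), basic (gammaForm φ (k + 2) q.1)])) +
  ∑ i : Fin 3, covectorWedge ![thetaForm σ i q.1, basic (cForm φ i q.1)]

/-- `ψ⁺ = ε (γ¹∧γ²∧γ³ - θ¹∧θ²∧γ³ - θ³∧θ¹∧γ² - θ²∧θ³∧γ¹)`. -/
def toricPsiPlus (φ : R3 → ℝ) (σ : Fin 3 → R3 → R3 →L[ℝ] ℝ) : MForm 3 ℝ := fun q =>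
  epsFun φ q.1 • (covectorWedge (fun i => basic (gammaForm φ i q.1)) -
    ∑ k : Fin 3, covectorWedge
      ![thetaForm σ (k + 1) q.1, thetaForm σ (k + 2) q.1, basic (gammaForm φ k q.1)])

/-- `ψ⁻ = ε (θ¹∧θ²∧θ³ - γ¹∧γ²∧θ³ - γ³∧γ¹∧θ² - γ²∧γ³∧θ¹)`. -/
def toricPsiMinus (φ : R3 → ℝ) (σ : Fin 3 → R3 → R3 →L[ℝ] ℝ) : MForm 3 ℝ := fun q =>
  epsFun φ q.1 • (covectorWedge (fun i => thetaForm σ i q.1) -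
    ∑ k : Fin 3, covectorWedge
      ![basic (gammaForm φ (k + 1) q.1), basic (gammaForm φ (k + 2) q.1), thetaForm σ k q.1])

/-- `S` is an `SU(3)`-structure on `W × T³` with the fundamental forms attached to `φ` and `σ`. -/
def HasToricForms {W : Set R3} (φ : R3 → ℝ) (σ : Fin 3 → R3 → R3 →L[ℝ] ℝ)
    (S : SU3Structure W) : Prop :=
  ∀ q : R3 × Torus3, q.1 ∈ W →
    S.omega q = toricOmega φ σ q ∧ S.psiPlus q = toricPsiPlus φ σ q ∧
    S.psiMinus q = toricPsiMinus φ σ q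

/-- The map `(y, x) ↦ (y, x + h y)`, which covers the `T³`-equivariant diffeomorphism
`(y, t) ↦ (y, t + [h y])` of `W × T³` (its inverse is given by `-h`). -/
def gaugeLift (h : R3 → R3) (p : Tan) : Tan := (p.1, p.2 + h p.1)

/-- The diffeomorphism covered by `gaugeLift h` pulls the form `α` back to `β`, over `W`. -/
def GaugePullsBack {k : ℕ} (W : Set R3) (h : R3 → R3) (α β : MForm k ℝ) : Prop :=
  ∀ p : Tan, p.1 ∈ W →
    (lift α (gaugeLift h p)).compContinuousLinearMap (fderiv ℝ (gaugeLift h) p) = lift β p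

end

/-! Everything is computed in the coframe (θ, γ) and reduces to a few structure equations on the
base. Write C for the Hessian of φ. Its symmetry makes cⁱ equal to -(3ε)⁻¹ d(∂ᵢφ), just as γⁱ is
-(3ε)⁻¹ dyᵢ. Both are therefore a common factor times an exact form, so dγⁱ = -ε⁻¹ dε∧γⁱ and dcⁱ =
-ε⁻¹ dε∧cⁱ. Since d(φ - ∂ᵣφ) = -∑ yᵢ d(∂ᵢφ), also dε = 4 ∑ yₗ cˡ. Finally ∂ᵣ²φ = ∂ᵣφ + yᵀCy turns
the Monge–Ampère equation into ε² = det C - yᵀCy. These facts form `BaseEquations`, established in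
`baseEquations`.

With them, dτᵢ = 0, dω = 3ψ⁺ and dψ⁻ = -2 ω∧ω become identities in the exterior algebra
(`BaseEquations.extDeriv_tauOf`, `BaseEquations.extDeriv_fundForm`,
`BaseEquations.extDeriv_imagVolForm`), once dθⁱ = 4τᵢ is used. The 3-forms in γ alone are multiples
of γ¹∧γ²∧γ³, and their coefficients cancel because of the formula for ε².

Algebraically, ψ = ε ζ¹∧ζ²∧ζ³ with ζⁱ = γⁱ - iθⁱ, so J must satisfy γⁱ∘J = θⁱ and θⁱ∘J = -γⁱ. The
metric with ω = g(J·,·) then has matrix D in the coframe (θ, γ), so it is positive exactly when D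
is. As ω³ = -6 (det C - yᵀCy) θ¹²³∧γ¹²³ and ψ∧ψ̄ = 8i ε² θ¹²³∧γ¹²³, the normalisation of ψ is again
the formula for ε² (`toricPsi_normalized`). Conversely ψ determines J, and ω with J determines g
(`eq_toricStructure`).

All coefficients depend on y alone, which gives torus invariance. The potentials come from the
Poincaré lemma on convex sets (`exists_primitive_of_closed_two_form`). Two of them differ by closed
1-forms, whose primitives are the components of the gauge map h (`IsPotential.exists_gauge`). -/

/-! ### Exterior algebra -/

/-! ### Decomposable forms as determinants. -/

section Wedge

variable {E A : Type*} [NormedAddCommGroup E] [NormedSpace ℝ E] [NormedCommRing A]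
  [NormedAlgebra ℝ A]

/-- The exterior product of `A`-valued covectors. -/
noncomputable def mulWedge {k : ℕ} (f : Fin k → E →L[ℝ] A) : E [⋀^Fin k]→L[ℝ] A :=
  ContinuousMultilinearMap.alternatization
    ((ContinuousMultilinearMap.mkPiAlgebra ℝ (Fin k) A).compContinuousLinearMap f)

theorem covectorWedge_eq_mulWedge {k : ℕ} (f : Fin k → E →L[ℝ] ℝ) :
    covectorWedge f = mulWedge f := rfl

theorem mulWedge_apply {k : ℕ} (f : Fin k → E →L[ℝ] A) (v : Fin k → E) :
    mulWedge f v = (Matrix.of fun i j => f i (v j)).det := by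
  rw [← Matrix.det_transpose, Matrix.det_apply]
  simp [mulWedge, ContinuousMultilinearMap.alternatization_apply_apply]

theorem covectorWedge_apply {k : ℕ} (f : Fin k → E →L[ℝ] ℝ) (v : Fin k → E) :
    covectorWedge f v = (Matrix.of fun i j => f i (v j)).det :=
  mulWedge_apply f v

theorem covectorWedge_two (a b : E →L[ℝ] ℝ) (v : Fin 2 → E) :
    covectorWedge ![a, b] v = a (v 0) * b (v 1) - a (v 1) * b (v 0) := by
  rw [covectorWedge_apply, Matrix.det_fin_two]; simp

theorem mulWedge_three (f : Fin 3 → E →L[ℝ] A) (v : Fin 3 → E) :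
    mulWedge f v =
      f 0 (v 0) * f 1 (v 1) * f 2 (v 2) - f 0 (v 0) * f 1 (v 2) * f 2 (v 1)
      - f 0 (v 1) * f 1 (v 0) * f 2 (v 2) + f 0 (v 1) * f 1 (v 2) * f 2 (v 0)
      + f 0 (v 2) * f 1 (v 0) * f 2 (v 1) - f 0 (v 2) * f 1 (v 1) * f 2 (v 0) := by
  rw [mulWedge_apply, Matrix.det_fin_three]; simp

theorem covectorWedge_three (f : Fin 3 → E →L[ℝ] ℝ) (v : Fin 3 → E) :
    covectorWedge f v =
      f 0 (v 0) * f 1 (v 1) * f 2 (v 2) - f 0 (v 0) * f 1 (v 2) * f 2 (v 1)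
      - f 0 (v 1) * f 1 (v 0) * f 2 (v 2) + f 0 (v 1) * f 1 (v 2) * f 2 (v 0)
      + f 0 (v 2) * f 1 (v 0) * f 2 (v 1) - f 0 (v 2) * f 1 (v 1) * f 2 (v 0) :=
  mulWedge_three f v

/-- The matrix of a change of covectors factors out of their exterior product. -/
theorem mulWedge_sum_smul {k : ℕ} (M : Matrix (Fin k) (Fin k) A) (β : Fin k → E →L[ℝ] A)
    (f : Fin k → E →L[ℝ] A) (hf : ∀ i u, f i u = ∑ j, M i j * β j u) (v : Fin k → E) :
    mulWedge f v = M.det * mulWedge β v := by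
  rw [mulWedge_apply, mulWedge_apply, ← Matrix.det_mul]
  congr 1
  ext i j
  simp [Matrix.mul_apply, hf]

theorem mulWedge_perm_of_sign_one {k : ℕ} (σ : Equiv.Perm (Fin k)) (hσ : Equiv.Perm.sign σ = 1)
    (f : Fin k → E →L[ℝ] A) (v : Fin k → E) : mulWedge (f ∘ σ) v = mulWedge f v := by
  rw [mulWedge_apply, mulWedge_apply]
  have := Matrix.det_permute σ (Matrix.of fun i j => f i (v j))
  rw [hσ] at this
  rw [Units.val_one, Int.cast_one, one_mul] at this
  exact this

/-- The shuffle product of two alternatizations is the alternatization of the tensor product, so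
both sides are the same signed sum over permutations. This reduces exterior products of decomposable
forms to determinants. -/
theorem wedge_mulWedge {k l : ℕ} (a : Fin k → E →L[ℝ] A) (b : Fin l → E →L[ℝ] A) :
    wedge (mulWedge a).toAlternatingMap (mulWedge b).toAlternatingMap =
      (mulWedge (Fin.append a b)).toAlternatingMap := by
  have h : ∀ {m : ℕ} (f : Fin m → E →L[ℝ] A), (mulWedge f).toAlternatingMap =
      MultilinearMap.alternatization
        ((ContinuousMultilinearMap.mkPiAlgebra ℝ (Fin m) A).compContinuousLinearMap
          f).toMultilinearMap := fun f => by
    ext v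
    simp [mulWedge, MultilinearMap.alternatization_apply]
  ext v
  have e : (mulWedge (Fin.append a b)).toAlternatingMap v = _ := mulWedge_apply _ _
  -- Indexing by `Fin k ⊕ Fin l` makes the Leibniz sum range over the same permutations as
  -- `domCoprod`.
  rw [e, ← Matrix.det_reindex_self finSumFinEquiv.symm, ← Matrix.det_transpose, Matrix.det_apply]
  rw [wedge, h, h, ← MultilinearMap.domCoprod_alternization]
  simp [MultilinearMap.alternatization_apply, MultilinearMap.domCoprod_apply, map_sum,
    Fintype.prod_sum_type]

theorem wedge_mulWedge_apply {k l : ℕ} (a : Fin k → E →L[ℝ] A) (b : Fin l → E →L[ℝ] A)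
    (v : Fin (k + l) → E) :
    wedge (mulWedge a).toAlternatingMap (mulWedge b).toAlternatingMap v =
      mulWedge (Fin.append a b) v := by
  rw [wedge_mulWedge]
  rfl

end Wedge

/-! ### Bilinearity of the exterior product. -/

section WedgeBilinear

variable {E A : Type*} [AddCommGroup E] [Module ℝ E] [CommRing A] [Algebra ℝ A] {k l : ℕ}

/-- Factoring through the tensor product makes the exterior product a linear map, from which
bilinearity is read off. -/
theorem wedge_eq_domCoprod' (a : E [⋀^Fin k]→ₗ[ℝ] A) (b : E [⋀^Fin l]→ₗ[ℝ] A)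
    (v : Fin (k + l) → E) :
    wedge a b v = LinearMap.mul' ℝ A
      (AlternatingMap.domCoprod' (a ⊗ₜ[ℝ] b) (fun i => v (finSumFinEquiv i))) := rfl

theorem wedge_add_left (a a' : E [⋀^Fin k]→ₗ[ℝ] A) (b : E [⋀^Fin l]→ₗ[ℝ] A)
    (v : Fin (k + l) → E) : wedge (a + a') b v = wedge a b v + wedge a' b v := by
  simp only [wedge_eq_domCoprod', TensorProduct.add_tmul, map_add, AlternatingMap.add_apply]

theorem wedge_add_right (a : E [⋀^Fin k]→ₗ[ℝ] A) (b b' : E [⋀^Fin l]→ₗ[ℝ] A)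
    (v : Fin (k + l) → E) : wedge a (b + b') v = wedge a b v + wedge a b' v := by
  simp only [wedge_eq_domCoprod', TensorProduct.tmul_add, map_add, AlternatingMap.add_apply]

theorem wedge_smul_smul (c d : ℝ) (a : E [⋀^Fin k]→ₗ[ℝ] A) (b : E [⋀^Fin l]→ₗ[ℝ] A)
    (v : Fin (k + l) → E) : wedge (c • a) (d • b) v = (c * d) • wedge a b v := by
  simp only [wedge_eq_domCoprod', TensorProduct.smul_tmul_smul, map_smul,
    AlternatingMap.smul_apply]

theorem wedge_zero_left (b : E [⋀^Fin l]→ₗ[ℝ] A) (v : Fin (k + l) → E) :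
    wedge (0 : E [⋀^Fin k]→ₗ[ℝ] A) b v = 0 := by
  simpa using wedge_smul_smul 0 1 (0 : E [⋀^Fin k]→ₗ[ℝ] A) b v

theorem wedge_zero_right (a : E [⋀^Fin k]→ₗ[ℝ] A) (v : Fin (k + l) → E) :
    wedge a (0 : E [⋀^Fin l]→ₗ[ℝ] A) v = 0 := by
  simpa using wedge_smul_smul 1 0 a (0 : E [⋀^Fin l]→ₗ[ℝ] A) v

theorem wedge_sum_left {ι : Type*} (s : Finset ι) (a : ι → E [⋀^Fin k]→ₗ[ℝ] A)
    (b : E [⋀^Fin l]→ₗ[ℝ] A) (v : Fin (k + l) → E) :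
    wedge (∑ i ∈ s, a i) b v = ∑ i ∈ s, wedge (a i) b v := by
  classical
  induction s using Finset.induction_on with
  | empty => simp [wedge_zero_left]
  | insert i s hi ih => rw [Finset.sum_insert hi, Finset.sum_insert hi, wedge_add_left, ih]

theorem wedge_sum_right {ι : Type*} (s : Finset ι) (a : E [⋀^Fin k]→ₗ[ℝ] A)
    (b : ι → E [⋀^Fin l]→ₗ[ℝ] A) (v : Fin (k + l) → E) :
    wedge a (∑ i ∈ s, b i) v = ∑ i ∈ s, wedge a (b i) v := by
  classical
  induction s using Finset.induction_on with
  | empty => simp [wedge_zero_right]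
  | insert i s hi ih => rw [Finset.sum_insert hi, Finset.sum_insert hi, wedge_add_right, ih]

end WedgeBilinear

/-! ### Squares and cubes of 2-forms. -/

section TwoForms

variable {E : Type*} [NormedAddCommGroup E] [NormedSpace ℝ E]

theorem toAlternatingMap_sum {ι F : Type*} [NormedAddCommGroup F] [NormedSpace ℝ F] {k : ℕ}
    (s : Finset ι) (a : ι → E [⋀^Fin k]→L[ℝ] F) :
    (∑ i ∈ s, a i).toAlternatingMap = ∑ i ∈ s, (a i).toAlternatingMap :=
  map_sum (ContinuousAlternatingMap.toAlternatingMapLinear (R := ℝ) (A := ℝ)) a s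

/-- The exterior square of a `2`-form. -/
theorem wedge_self_two {n : ℕ} (a b : Fin n → E →L[ℝ] ℝ) (v : Fin 4 → E)
    (α : E [⋀^Fin 2]→L[ℝ] ℝ) (hα : α = ∑ s, covectorWedge ![a s, b s]) :
    wedge α.toAlternatingMap α.toAlternatingMap v =
      2 * (α ![v 0, v 1] * α ![v 2, v 3] - α ![v 0, v 2] * α ![v 1, v 3]
        + α ![v 0, v 3] * α ![v 1, v 2]) := by
  have key : ∀ s t, wedge (covectorWedge ![a s, b s]).toAlternatingMap
      (covectorWedge ![a t, b t]).toAlternatingMap v =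
      covectorWedge ![a s, b s] ![v 0, v 1] * covectorWedge ![a t, b t] ![v 2, v 3]
      - covectorWedge ![a s, b s] ![v 0, v 2] * covectorWedge ![a t, b t] ![v 1, v 3]
      + covectorWedge ![a s, b s] ![v 0, v 3] * covectorWedge ![a t, b t] ![v 1, v 2]
      + covectorWedge ![a s, b s] ![v 1, v 2] * covectorWedge ![a t, b t] ![v 0, v 3]
      - covectorWedge ![a s, b s] ![v 1, v 3] * covectorWedge ![a t, b t] ![v 0, v 2]
      + covectorWedge ![a s, b s] ![v 2, v 3] * covectorWedge ![a t, b t] ![v 0, v 1] := by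
    intro s t
    simp only [covectorWedge_two]
    rw [covectorWedge_eq_mulWedge, covectorWedge_eq_mulWedge, wedge_mulWedge]
    refine (mulWedge_apply _ _).trans ?_
    rw [Matrix.det_succ_row_zero]
    simp [Fin.sum_univ_succ, Matrix.det_fin_three, Fin.append, Fin.addCases, Fin.succAbove]
    ring
  have hs : ∀ u w : E, α ![u, w] = ∑ s, covectorWedge ![a s, b s] ![u, w] := by
    intro u w; rw [hα]; simp
  have h2 : wedge α.toAlternatingMap α.toAlternatingMap v = ∑ s, ∑ t,
      wedge (covectorWedge ![a s, b s]).toAlternatingMap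
        (covectorWedge ![a t, b t]).toAlternatingMap v := by
    rw [hα, toAlternatingMap_sum, wedge_sum_left]
    simp_rw [wedge_sum_right]
  rw [h2]
  -- After summation over s and t the six shuffles coincide in pairs, whence the factor 2.
  simp only [key, Finset.sum_add_distrib, Finset.sum_sub_distrib, ← Finset.sum_mul_sum, ← hs]
  ring

/-- Only triples of distinct indices contribute, and each of the ten 3-element subsets is counted 3!
times. -/
theorem sum_fin_five_of_symm {R : Type*} [CommRing R] (T : Fin 5 → Fin 5 → Fin 5 → R)
    (h12 : ∀ s t r, T s t r = T t s r) (h23 : ∀ s t r, T s t r = T s r t)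
    (h0 : ∀ s r, T s s r = 0) :
    ∑ s, ∑ t, ∑ r, T s t r = 6 * (T 0 1 2 + T 0 1 3 + T 0 1 4 + T 0 2 3 + T 0 2 4 + T 0 3 4
      + T 1 2 3 + T 1 2 4 + T 1 3 4 + T 2 3 4) := by
  have h0' : ∀ s r, T r s s = 0 := fun s r => by rw [h12, h23, h0]
  have h0'' : ∀ s r, T s r s = 0 := fun s r => by rw [h23, h0]
  simp only [Fin.sum_univ_five, h0, h0', h0'', h12 1 0, h12 2 0, h12 3 0, h12 4 0, h12 2 1,
    h12 3 1, h12 4 1, h12 3 2, h12 4 2, h23 _ 1 0, h23 _ 2 0, h23 _ 3 0, h23 _ 4 0,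
    h23 _ 2 1, h23 _ 3 1, h23 _ 4 1, h23 _ 3 2, h23 _ 4 2, h23 _ 4 3]
  ring

/-- The exterior cube of a sum of five decomposable `2`-forms. -/
theorem wedge_cube_two (a b : Fin 5 → E →L[ℝ] ℝ) (v : Fin 6 → E)
    (α : E [⋀^Fin 2]→L[ℝ] ℝ) (hα : α = ∑ s, covectorWedge ![a s, b s])
    (T : Fin 5 → Fin 5 → Fin 5 → ℝ)
    (hT : ∀ s t r, T s t r = mulWedge (k := 6) ![a s, b s, a t, b t, a r, b r] v) :
    wedge (wedge α.toAlternatingMap α.toAlternatingMap) α.toAlternatingMap v =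
      6 * (T 0 1 2 + T 0 1 3 + T 0 1 4 + T 0 2 3 + T 0 2 4 + T 0 3 4
      + T 1 2 3 + T 1 2 4 + T 1 3 4 + T 2 3 4) := by
  rw [← sum_fin_five_of_symm]
  · have h2 : wedge α.toAlternatingMap α.toAlternatingMap = ∑ s, ∑ t,
        (mulWedge (k := 4) ![a s, b s, a t, b t]).toAlternatingMap := by
      have h3 : ∀ s t, (mulWedge (k := 4) ![a s, b s, a t, b t]).toAlternatingMap =
          wedge (covectorWedge ![a s, b s]).toAlternatingMap
            (covectorWedge ![a t, b t]).toAlternatingMap := by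
        intro s t
        rw [covectorWedge_eq_mulWedge, covectorWedge_eq_mulWedge, wedge_mulWedge]
        congr 2
        ext i
        fin_cases i <;> rfl
      have h4 : ∑ s, ∑ t, (mulWedge (k := 4) ![a s, b s, a t, b t]).toAlternatingMap =
          (∑ s, ∑ t, mulWedge (k := 4) ![a s, b s, a t, b t]).toAlternatingMap := by
        rw [toAlternatingMap_sum]
        exact Finset.sum_congr rfl fun s _ => (toAlternatingMap_sum _ _).symm
      ext w
      rw [h4]
      change _ = (∑ s, ∑ t, mulWedge (k := 4) ![a s, b s, a t, b t]) w
      rw [ContinuousAlternatingMap.sum_apply, hα, toAlternatingMap_sum, wedge_sum_left]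
      refine Finset.sum_congr rfl fun s _ => ?_
      rw [ContinuousAlternatingMap.sum_apply, wedge_sum_right]
      refine Finset.sum_congr rfl fun t _ => ?_
      rw [← h3]
      rfl
    rw [h2, wedge_sum_left]
    refine Finset.sum_congr rfl fun s _ => ?_
    rw [wedge_sum_left]
    refine Finset.sum_congr rfl fun t _ => ?_
    rw [hα, toAlternatingMap_sum, wedge_sum_right]
    refine Finset.sum_congr rfl fun r _ => ?_
    rw [hT, covectorWedge_eq_mulWedge, wedge_mulWedge_apply]
    congr 2
    ext i
    fin_cases i <;> rfl
  -- 2-forms commute: exchanging two blocks of two covectors is an even permutation.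
  · intro s t r
    rw [hT, hT, ← mulWedge_perm_of_sign_one (Equiv.swap 0 2 * Equiv.swap 1 3) (by decide)]
    congr 2
    ext i
    fin_cases i <;> rfl
  · intro s t r
    rw [hT, hT, ← mulWedge_perm_of_sign_one (Equiv.swap 2 4 * Equiv.swap 3 5) (by decide)]
    congr 2
    ext i
    fin_cases i <;> rfl
  · intro s r
    rw [hT, mulWedge_apply]
    exact Matrix.det_zero_of_row_eq (i := 0) (j := 2) (by decide) rfl

end TwoForms

/-! ### The fundamental form in the coframe (θ, γ). -/

section Coframe

variable {E : Type*} [NormedAddCommGroup E] [NormedSpace ℝ E]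

/-- The fundamental `2`-form `∑ yₖ (θⁱ∧θʲ + γⁱ∧γʲ) + ∑ θⁱ∧cⁱ` built from covectors `θ`, `γ`, `c`. -/
noncomputable def fundForm (y : R3) (θ γ c : Fin 3 → E →L[ℝ] ℝ) : E [⋀^Fin 2]→L[ℝ] ℝ :=
  (∑ k : Fin 3, y k • (covectorWedge ![θ (k + 1), θ (k + 2)] +
      covectorWedge ![γ (k + 1), γ (k + 2)])) +
    ∑ i : Fin 3, covectorWedge ![θ i, c i]

theorem fundForm_apply (y : R3) (θ γ c : Fin 3 → E →L[ℝ] ℝ) (u v : E) :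
    fundForm y θ γ c ![u, v] =
      y 0 * (θ 1 u * θ 2 v - θ 1 v * θ 2 u + (γ 1 u * γ 2 v - γ 1 v * γ 2 u))
      + y 1 * (θ 2 u * θ 0 v - θ 2 v * θ 0 u + (γ 2 u * γ 0 v - γ 2 v * γ 0 u))
      + y 2 * (θ 0 u * θ 1 v - θ 0 v * θ 1 u + (γ 0 u * γ 1 v - γ 0 v * γ 1 u))
      + (θ 0 u * c 0 v - θ 0 v * c 0 u) + (θ 1 u * c 1 v - θ 1 v * c 1 u)
      + (θ 2 u * c 2 v - θ 2 v * c 2 u) := by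
  simp [fundForm, Fin.sum_univ_three, covectorWedge_two]
  ring

/-- Collecting the nine terms by a common first factor leaves five decomposable forms, so that the
cube involves only ten determinants. -/
theorem fundForm_eq_sum (y : R3) (θ γ c : Fin 3 → E →L[ℝ] ℝ) :
    fundForm y θ γ c = ∑ s : Fin 5, covectorWedge
      ![(![θ 0, θ 1, θ 2, γ 0, γ 1] : Fin 5 → E →L[ℝ] ℝ) s,
        (![c 0 + y 2 • θ 1 - y 1 • θ 2, c 1 + y 0 • θ 2, c 2, y 2 • γ 1 - y 1 • γ 2,
          y 0 • γ 2] : Fin 5 → E →L[ℝ] ℝ) s] := by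
  ext v
  have hv : v = ![v 0, v 1] := by ext i; fin_cases i <;> rfl
  rw [hv, fundForm_apply]
  simp [Fin.sum_univ_five, covectorWedge_two]
  ring

theorem wedge_self_fundForm (y : R3) (θ γ c : Fin 3 → E →L[ℝ] ℝ) (v : Fin 4 → E) :
    wedge (fundForm y θ γ c).toAlternatingMap (fundForm y θ γ c).toAlternatingMap v =
      2 * (fundForm y θ γ c ![v 0, v 1] * fundForm y θ γ c ![v 2, v 3]
        - fundForm y θ γ c ![v 0, v 2] * fundForm y θ γ c ![v 1, v 3]
        + fundForm y θ γ c ![v 0, v 3] * fundForm y θ γ c ![v 1, v 2]) :=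
  wedge_self_two _ _ v _ (fundForm_eq_sum y θ γ c)

theorem wedge_cube_two_of_coeff (A B : Fin 5 → E →L[ℝ] ℝ) (β : Fin 6 → E →L[ℝ] ℝ)
    (a b : Fin 5 → Fin 6 → ℝ) (hA : ∀ s u, A s u = ∑ j, a s j * β j u)
    (hB : ∀ s u, B s u = ∑ j, b s j * β j u) (M : Fin 5 → Fin 5 → Fin 5 → Matrix (Fin 6) (Fin 6) ℝ)
    (hM : ∀ s t r, M s t r = Matrix.of ![a s, b s, a t, b t, a r, b r]) (v : Fin 6 → E)
    (α : E [⋀^Fin 2]→L[ℝ] ℝ) (hα : α = ∑ s, covectorWedge ![A s, B s]) :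
    wedge (wedge α.toAlternatingMap α.toAlternatingMap) α.toAlternatingMap v =
      6 * ((M 0 1 2).det + (M 0 1 3).det + (M 0 1 4).det + (M 0 2 3).det + (M 0 2 4).det
        + (M 0 3 4).det + (M 1 2 3).det + (M 1 2 4).det + (M 1 3 4).det + (M 2 3 4).det)
        * mulWedge β v := by
  have h : ∀ s t r, (M s t r).det * mulWedge β v =
      mulWedge (k := 6) ![A s, B s, A t, B t, A r, B r] v := fun s t r => by
    refine (mulWedge_sum_smul (M s t r) β _ ?_ v).symm
    intro i u
    rw [hM]
    fin_cases i
    exacts [hA s u, hB s u, hA t u, hB t u, hA r u, hB r u]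
  rw [wedge_cube_two A B v α hα _ h]
  ring

set_option maxHeartbeats 2000000 in
/-- The exterior cube of the fundamental form. -/
theorem wedge_cube_fundForm (y : R3) (θ γ c : Fin 3 → E →L[ℝ] ℝ) (C : Matrix (Fin 3) (Fin 3) ℝ)
    (hc : ∀ i u, c i u = ∑ j, C i j * γ j u) (v : Fin 6 → E) :
    wedge (wedge (fundForm y θ γ c).toAlternatingMap
      (fundForm y θ γ c).toAlternatingMap) (fundForm y θ γ c).toAlternatingMap v =
      -6 * (C.det - y ⬝ᵥ C *ᵥ y) * mulWedge (k := 6) ![θ 0, θ 1, θ 2, γ 0, γ 1, γ 2] v := by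
  -- `a` and `b` hold the coordinates, in the coframe (θ, γ), of the first and second factors in
  -- `fundForm_eq_sum`.
  let a : Fin 5 → Fin 6 → ℝ := ![![1, 0, 0, 0, 0, 0], ![0, 1, 0, 0, 0, 0], ![0, 0, 1, 0, 0, 0],
    ![0, 0, 0, 1, 0, 0], ![0, 0, 0, 0, 1, 0]]
  let b : Fin 5 → Fin 6 → ℝ := ![![0, y 2, -y 1, C 0 0, C 0 1, C 0 2],
    ![0, 0, y 0, C 1 0, C 1 1, C 1 2], ![0, 0, 0, C 2 0, C 2 1, C 2 2],
    ![0, 0, 0, 0, y 2, -y 1], ![0, 0, 0, 0, 0, y 0]]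
  let M : Fin 5 → Fin 5 → Fin 5 → Matrix (Fin 6) (Fin 6) ℝ := fun s t r =>
    Matrix.of ![a s, b s, a t, b t, a r, b r]
  have ha : ∀ s u, (![θ 0, θ 1, θ 2, γ 0, γ 1] : Fin 5 → E →L[ℝ] ℝ) s u =
      ∑ j, a s j * (![θ 0, θ 1, θ 2, γ 0, γ 1, γ 2] : Fin 6 → E →L[ℝ] ℝ) j u := by
    intro s u
    fin_cases s <;> simp [a, Fin.sum_univ_six]
  have hb : ∀ s u, (![c 0 + y 2 • θ 1 - y 1 • θ 2, c 1 + y 0 • θ 2, c 2, y 2 • γ 1 - y 1 • γ 2,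
          y 0 • γ 2] : Fin 5 → E →L[ℝ] ℝ) s u =
      ∑ j, b s j * (![θ 0, θ 1, θ 2, γ 0, γ 1, γ 2] : Fin 6 → E →L[ℝ] ℝ) j u := by
    intro s u
    fin_cases s <;> simp [b, Fin.sum_univ_six, hc, Fin.sum_univ_three] <;> ring
  have hM : (M 0 1 2).det + (M 0 1 3).det + (M 0 1 4).det + (M 0 2 3).det + (M 0 2 4).det
      + (M 0 3 4).det + (M 1 2 3).det + (M 1 2 4).det + (M 1 3 4).det + (M 2 3 4).det =
      -(C.det - y ⬝ᵥ C *ᵥ y) := by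
    simp [M, a, b, Matrix.det_succ_row_zero, Fin.sum_univ_succ, Fin.succAbove, Matrix.mulVec,
      dotProduct]
    ring
  rw [wedge_cube_two_of_coeff _ _ _ a b ha hb M (fun _ _ _ => rfl) v _ (fundForm_eq_sum y θ γ c),
    hM]
  ring

end Coframe

/-! ### Regularity of form-valued maps, tested on fixed vectors. -/

section Criterion

variable {X E F : Type*} [NormedAddCommGroup X] [NormedSpace ℝ X] [NormedAddCommGroup E]
  [NormedSpace ℝ E] [FiniteDimensional ℝ E] [NormedAddCommGroup F] [NormedSpace ℝ F]
  [FiniteDimensional ℝ F] {k : ℕ}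

/-- Alternating maps on a finite-dimensional space are recovered linearly and continuously from
their values on tuples of basis vectors. -/
theorem exists_alternating_reconstruction (E F : Type*) [NormedAddCommGroup E]
    [NormedSpace ℝ E] [FiniteDimensional ℝ E] [NormedAddCommGroup F] [NormedSpace ℝ F]
    [FiniteDimensional ℝ F] (k : ℕ) :
    ∃ L : ((Fin k → Fin (Module.finrank ℝ E)) → F) →L[ℝ] E [⋀^Fin k]→L[ℝ] F,
      ∀ f : E [⋀^Fin k]→L[ℝ] F, L (fun s => f (fun i => Module.finBasis ℝ E (s i))) = f := by
  let ev : E [⋀^Fin k]→L[ℝ] F →ₗ[ℝ] ((Fin k → Fin (Module.finrank ℝ E)) → F) :=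
    { toFun := fun f s => f (fun i => Module.finBasis ℝ E (s i))
      map_add' := fun f g => rfl
      map_smul' := fun c f => rfl }
  have hinj : LinearMap.ker ev = ⊥ := by
    rw [LinearMap.ker_eq_bot]
    intro f g hfg
    apply ContinuousAlternatingMap.toAlternatingMap_injective
    refine Module.Basis.ext_alternating (Module.finBasis ℝ E) fun s _ => congrFun hfg s
  obtain ⟨L, hL⟩ := ev.exists_leftInverse_of_injective hinj
  exact ⟨⟨L, L.continuous_of_finiteDimensional⟩, fun f => LinearMap.congr_fun hL f⟩

/-- The map is a fixed continuous linear map applied to its finitely many values on basis tuples. -/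
theorem contDiffOn_alternating_of_apply {n : WithTop ℕ∞} {f : X → E [⋀^Fin k]→L[ℝ] F} {s : Set X}
    (h : ∀ v, ContDiffOn ℝ n (fun x => f x v) s) : ContDiffOn ℝ n f s := by
  obtain ⟨L, hL⟩ := exists_alternating_reconstruction E F k
  have : f = fun x => L (fun s => f x (fun i => Module.finBasis ℝ E (s i))) :=
    funext fun x => (hL (f x)).symm
  rw [this]
  exact L.contDiff.comp_contDiffOn (contDiffOn_pi.2 fun s => h _)

theorem differentiableAt_alternating_of_apply {f : X → E [⋀^Fin k]→L[ℝ] F} {x : X}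
    (h : ∀ v, DifferentiableAt ℝ (fun x => f x v) x) : DifferentiableAt ℝ f x := by
  obtain ⟨L, hL⟩ := exists_alternating_reconstruction E F k
  have : f = fun x => L (fun s => f x (fun i => Module.finBasis ℝ E (s i))) :=
    funext fun x => (hL (f x)).symm
  rw [this]
  exact L.differentiableAt.comp x (differentiableAt_pi.2 fun s => h _)

end Criterion

/-! ### Exterior derivatives of f a∧b and f a∧b∧c. -/

section ProductRule

variable {E : Type*} [NormedAddCommGroup E] [NormedSpace ℝ E] [FiniteDimensional ℝ E]

omit [FiniteDimensional ℝ E] in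
theorem hasFDerivAt_apply_vec {a : E → E →L[ℝ] ℝ} {a' : E →L[ℝ] E →L[ℝ] ℝ} {p : E}
    (ha : HasFDerivAt a a' p) (u : E) : HasFDerivAt (fun q => a q u) (a'.flip u) p := by
  simpa using ha.clm_apply (hasFDerivAt_const u p)

/-- The exterior derivative of a `1`-form. -/
theorem extDeriv_oneForm_apply {a : E → E →L[ℝ] ℝ} {a' : E →L[ℝ] E →L[ℝ] ℝ} {p : E}
    (ha : HasFDerivAt a a' p) (v : Fin 2 → E) :
    extDeriv (fun q => oneForm (a q)) p v = a' (v 0) (v 1) - a' (v 1) (v 0) := by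
  have h1 : ∀ u : Fin 1 → E, HasFDerivAt (fun q => oneForm (a q) u) (a'.flip (u 0)) p :=
    fun u => hasFDerivAt_apply_vec ha (u 0)
  rw [extDeriv_apply (differentiableAt_alternating_of_apply fun u => (h1 u).differentiableAt)]
  refine (Fin.sum_univ_two _).trans ?_
  simp only [(h1 _).fderiv]
  simp [Fin.removeNth, sub_eq_add_neg]

omit [FiniteDimensional ℝ E] in
theorem hasFDerivAt_smul_covectorWedge_two {f : E → ℝ} {f' : E →L[ℝ] ℝ} {a b : E → E →L[ℝ] ℝ}
    {a' b' : E →L[ℝ] E →L[ℝ] ℝ} {p : E} (hf : HasFDerivAt f f' p) (ha : HasFDerivAt a a' p)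
    (hb : HasFDerivAt b b' p) (u : Fin 2 → E) :
    ∃ D : E →L[ℝ] ℝ, HasFDerivAt (fun q => (f q • covectorWedge ![a q, b q]) u) D p ∧
      ∀ w, D w = f' w * (a p (u 0) * b p (u 1) - a p (u 1) * b p (u 0))
        + f p * (a' w (u 0) * b p (u 1) + a p (u 0) * b' w (u 1)
          - a' w (u 1) * b p (u 0) - a p (u 1) * b' w (u 0)) := by
  have h := hf.mul (((hasFDerivAt_apply_vec ha (u 0)).mul (hasFDerivAt_apply_vec hb (u 1))).sub
    ((hasFDerivAt_apply_vec ha (u 1)).mul (hasFDerivAt_apply_vec hb (u 0))))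
  refine ⟨_, h.congr_of_eventuallyEq (Filter.Eventually.of_forall fun q => ?_), fun w => ?_⟩
  · simp [covectorWedge_two]
  · simp
    ring

/-- The exterior derivative of `f a∧b`. -/
theorem extDeriv_smul_covectorWedge_two {f : E → ℝ} {f' : E →L[ℝ] ℝ} {a b : E → E →L[ℝ] ℝ}
    {a' b' : E →L[ℝ] E →L[ℝ] ℝ} {p : E} (hf : HasFDerivAt f f' p) (ha : HasFDerivAt a a' p)
    (hb : HasFDerivAt b b' p) (da db : E → E → ℝ) (hda : ∀ u w, a' u w - a' w u = da u w)
    (hdb : ∀ u w, b' u w - b' w u = db u w) :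
    DifferentiableAt ℝ (fun q => f q • covectorWedge ![a q, b q]) p ∧ ∀ v,
    extDeriv (fun q => f q • covectorWedge ![a q, b q]) p v =
      f' (v 0) * (a p (v 1) * b p (v 2) - a p (v 2) * b p (v 1))
      - f' (v 1) * (a p (v 0) * b p (v 2) - a p (v 2) * b p (v 0))
      + f' (v 2) * (a p (v 0) * b p (v 1) - a p (v 1) * b p (v 0))
      + f p * (da (v 0) (v 1) * b p (v 2) - da (v 0) (v 2) * b p (v 1) + da (v 1) (v 2) * b p (v 0)
        - (a p (v 0) * db (v 1) (v 2) - a p (v 1) * db (v 0) (v 2)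
          + a p (v 2) * db (v 0) (v 1))) := by
  choose D hD hD' using hasFDerivAt_smul_covectorWedge_two hf ha hb
  have hd : DifferentiableAt ℝ (fun q => f q • covectorWedge ![a q, b q]) p :=
    differentiableAt_alternating_of_apply fun u => (hD u).differentiableAt
  refine ⟨hd, fun v => ?_⟩
  rw [extDeriv_apply hd]
  refine (Fin.sum_univ_three _).trans ?_
  simp only [(hD _).fderiv, hD', ← hda, ← hdb]
  simp [Fin.removeNth, Fin.succAbove]
  ring

omit [FiniteDimensional ℝ E] in
theorem hasFDerivAt_smul_covectorWedge_three {f : E → ℝ} {f' : E →L[ℝ] ℝ}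
    {a b c : E → E →L[ℝ] ℝ} {a' b' c' : E →L[ℝ] E →L[ℝ] ℝ} {p : E} (hf : HasFDerivAt f f' p)
    (ha : HasFDerivAt a a' p) (hb : HasFDerivAt b b' p) (hc : HasFDerivAt c c' p)
    (u : Fin 3 → E) :
    ∃ D : E →L[ℝ] ℝ, HasFDerivAt (fun q => (f q • covectorWedge ![a q, b q, c q]) u) D p ∧
      ∀ w, D w = f' w * covectorWedge ![a p, b p, c p] u
        + f p * (covectorWedge ![a' w, b p, c p] u + covectorWedge ![a p, b' w, c p] u
          + covectorWedge ![a p, b p, c' w] u) := by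
  have A := fun i => hasFDerivAt_apply_vec ha (u i)
  have B := fun i => hasFDerivAt_apply_vec hb (u i)
  have C := fun i => hasFDerivAt_apply_vec hc (u i)
  have h := hf.mul ((((((A 0).mul (B 1)).mul (C 2)).sub (((A 0).mul (B 2)).mul (C 1))).sub
    (((A 1).mul (B 0)).mul (C 2))).add (((A 1).mul (B 2)).mul (C 0)) |>.add
    (((A 2).mul (B 0)).mul (C 1)) |>.sub (((A 2).mul (B 1)).mul (C 0)))
  refine ⟨_, h.congr_of_eventuallyEq (Filter.Eventually.of_forall fun q => ?_), fun w => ?_⟩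
  · simp [covectorWedge_three]
  · simp [covectorWedge_three]
    ring

/-- The exterior derivative of `f a∧b∧c`. -/
theorem extDeriv_smul_covectorWedge_three {f : E → ℝ} {f' : E →L[ℝ] ℝ}
    {a b c : E → E →L[ℝ] ℝ} {a' b' c' : E →L[ℝ] E →L[ℝ] ℝ} {p : E} (hf : HasFDerivAt f f' p)
    (ha : HasFDerivAt a a' p) (hb : HasFDerivAt b b' p) (hc : HasFDerivAt c c' p)
    (da db dc : E → E → ℝ) (hda : ∀ u w, a' u w - a' w u = da u w)
    (hdb : ∀ u w, b' u w - b' w u = db u w) (hdc : ∀ u w, c' u w - c' w u = dc u w) :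
    DifferentiableAt ℝ (fun q => f q • covectorWedge ![a q, b q, c q]) p ∧ ∀ v,
    extDeriv (fun q => f q • covectorWedge ![a q, b q, c q]) p v =
      f' (v 0) * covectorWedge ![a p, b p, c p] ![v 1, v 2, v 3]
      - f' (v 1) * covectorWedge ![a p, b p, c p] ![v 0, v 2, v 3]
      + f' (v 2) * covectorWedge ![a p, b p, c p] ![v 0, v 1, v 3]
      - f' (v 3) * covectorWedge ![a p, b p, c p] ![v 0, v 1, v 2]
      + f p * (
        (da (v 0) (v 1) * covectorWedge ![b p, c p] ![v 2, v 3]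
        - da (v 0) (v 2) * covectorWedge ![b p, c p] ![v 1, v 3]
        + da (v 0) (v 3) * covectorWedge ![b p, c p] ![v 1, v 2]
        + da (v 1) (v 2) * covectorWedge ![b p, c p] ![v 0, v 3]
        - da (v 1) (v 3) * covectorWedge ![b p, c p] ![v 0, v 2]
        + da (v 2) (v 3) * covectorWedge ![b p, c p] ![v 0, v 1])
        - (db (v 0) (v 1) * covectorWedge ![a p, c p] ![v 2, v 3]
        - db (v 0) (v 2) * covectorWedge ![a p, c p] ![v 1, v 3]
        + db (v 0) (v 3) * covectorWedge ![a p, c p] ![v 1, v 2]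
        + db (v 1) (v 2) * covectorWedge ![a p, c p] ![v 0, v 3]
        - db (v 1) (v 3) * covectorWedge ![a p, c p] ![v 0, v 2]
        + db (v 2) (v 3) * covectorWedge ![a p, c p] ![v 0, v 1])
        + (dc (v 0) (v 1) * covectorWedge ![a p, b p] ![v 2, v 3]
        - dc (v 0) (v 2) * covectorWedge ![a p, b p] ![v 1, v 3]
        + dc (v 0) (v 3) * covectorWedge ![a p, b p] ![v 1, v 2]
        + dc (v 1) (v 2) * covectorWedge ![a p, b p] ![v 0, v 3]
        - dc (v 1) (v 3) * covectorWedge ![a p, b p] ![v 0, v 2]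
        + dc (v 2) (v 3) * covectorWedge ![a p, b p] ![v 0, v 1])) := by
  choose D hD hD' using hasFDerivAt_smul_covectorWedge_three hf ha hb hc
  have hd : DifferentiableAt ℝ (fun q => f q • covectorWedge ![a q, b q, c q]) p :=
    differentiableAt_alternating_of_apply fun u => (hD u).differentiableAt
  refine ⟨hd, fun v => ?_⟩
  rw [extDeriv_apply hd]
  refine (Fin.sum_univ_four _).trans ?_
  simp only [(hD _).fderiv, hD', ← hda, ← hdb, ← hdc]
  have r0 : Fin.removeNth 0 v = ![v 1, v 2, v 3] := by ext i; fin_cases i <;> rfl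
  have r1 : Fin.removeNth 1 v = ![v 0, v 2, v 3] := by ext i; fin_cases i <;> rfl
  have r2 : Fin.removeNth 2 v = ![v 0, v 1, v 3] := by ext i; fin_cases i <;> rfl
  have r3 : Fin.removeNth 3 v = ![v 0, v 1, v 2] := by ext i; fin_cases i <;> rfl
  rw [r0, r1, r2, r3]
  simp [covectorWedge_two, covectorWedge_three]
  ring

end ProductRule

/-! ### The complex volume form and the complex structure it determines. -/

section HolomorphicVolume

variable {E : Type*} [NormedAddCommGroup E] [NormedSpace ℝ E]

/-- The complex covectors `γⁱ - i θⁱ`. -/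
noncomputable def zetaForm (θ γ : Fin 3 → E →L[ℝ] ℝ) (i : Fin 3) : E →L[ℝ] ℂ :=
  Complex.ofRealCLM.comp (γ i) - Complex.I • Complex.ofRealCLM.comp (θ i)

theorem zetaForm_apply (θ γ : Fin 3 → E →L[ℝ] ℝ) (i : Fin 3) (u : E) :
    zetaForm θ γ i u = (γ i u : ℂ) - Complex.I * (θ i u : ℂ) := by
  simp [zetaForm]

/-- The complex volume form `e ζ¹∧ζ²∧ζ³` with `ζⁱ = γⁱ - i θⁱ`. -/
noncomputable def holForm (e : ℝ) (θ γ : Fin 3 → E →L[ℝ] ℝ) : E [⋀^Fin 3]→L[ℝ] ℂ :=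
  e • mulWedge (zetaForm θ γ)

/-- The real part of `holForm`. -/
noncomputable def realVolForm (e : ℝ) (θ γ : Fin 3 → E →L[ℝ] ℝ) : E [⋀^Fin 3]→L[ℝ] ℝ :=
  e • (covectorWedge (fun i => γ i) -
    ∑ k : Fin 3, covectorWedge ![θ (k + 1), θ (k + 2), γ k])

/-- The imaginary part of `holForm`. -/
noncomputable def imagVolForm (e : ℝ) (θ γ : Fin 3 → E →L[ℝ] ℝ) : E [⋀^Fin 3]→L[ℝ] ℝ :=
  e • (covectorWedge (fun i => θ i) -
    ∑ k : Fin 3, covectorWedge ![γ (k + 1), γ (k + 2), θ k])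

theorem holForm_apply (e : ℝ) (θ γ : Fin 3 → E →L[ℝ] ℝ) (v : Fin 3 → E) :
    holForm e θ γ v = (realVolForm e θ γ v : ℂ) + Complex.I * (imagVolForm e θ γ v : ℂ) := by
  have hI : Complex.I ^ 2 = -1 := Complex.I_sq
  have hI3 : Complex.I ^ 3 = -Complex.I := by rw [pow_succ, hI]; ring
  simp [holForm, realVolForm, imagVolForm, mulWedge_three, covectorWedge_three, zetaForm_apply,
    Fin.sum_univ_three]
  ring_nf
  rw [hI3, hI]
  ring

theorem re_holForm (e : ℝ) (θ γ : Fin 3 → E →L[ℝ] ℝ) :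
    Complex.reCLM.compContinuousAlternatingMap (holForm e θ γ) = realVolForm e θ γ := by
  ext v
  simp [holForm_apply]

theorem im_holForm (e : ℝ) (θ γ : Fin 3 → E →L[ℝ] ℝ) :
    Complex.imCLM.compContinuousAlternatingMap (holForm e θ γ) = imagVolForm e θ γ := by
  ext v
  simp [holForm_apply]

theorem holForm_map (e : ℝ) (θ γ : Fin 3 → E →L[ℝ] ℝ) (J : E → E)
    (hγ : ∀ i u, γ i (J u) = θ i u) (hθ : ∀ i u, θ i (J u) = -γ i u) (u v w : E) :
    holForm e θ γ ![J u, v, w] = Complex.I * holForm e θ γ ![u, v, w] := by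
  have hz : ∀ i, zetaForm θ γ i (J u) = Complex.I * zetaForm θ γ i u := fun i => by
    rw [zetaForm_apply, zetaForm_apply, hγ, hθ]
    push_cast
    linear_combination (θ i u : ℂ) * Complex.I_mul_I
  simp [holForm, mulWedge_three, hz]
  ring

/-- The complex structure is determined by the complex volume form. -/
theorem eq_of_holForm_map {e : ℝ} (he : e ≠ 0) (θ γ : Fin 3 → E →L[ℝ] ℝ) (d : Fin 3 → E)
    (hγ : ∀ i j, γ i (d j) = if i = j then 1 else 0) (hθ : ∀ i j, θ i (d j) = 0) (u u' : E)
    (h : ∀ v w, holForm e θ γ ![u', v, w] = Complex.I * holForm e θ γ ![u, v, w]) (i : Fin 3) :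
    γ i u' = θ i u ∧ θ i u' = -γ i u := by
  have hz : ∀ i j, zetaForm θ γ i (d j) = if i = j then 1 else 0 := fun i j => by
    rw [zetaForm_apply, hγ, hθ]
    split_ifs <;> simp
  have key : zetaForm θ γ i u' = Complex.I * zetaForm θ γ i u := by
    -- On these two dual vectors the other two ζ's take the values 0 and 1, so only e ζⁱ survives;
    -- its sign is + because the permutation is cyclic.
    have h1 := h (d (i + 1)) (d (i + 2))
    have he' : (e : ℂ) ≠ 0 := by exact_mod_cast he
    fin_cases i <;> simp [holForm, mulWedge_three, hz] at h1 ⊢ <;>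
      exact mul_left_cancel₀ he' (by rw [h1]; ring)
  rw [zetaForm_apply, zetaForm_apply] at key
  have hre := congrArg Complex.re key
  have him := congrArg Complex.im key
  simp at hre him
  exact ⟨hre, by linarith⟩

theorem mulWedge_ofReal {k : ℕ} (β : Fin k → E →L[ℝ] ℝ) (v : Fin k → E) :
    mulWedge (fun i => Complex.ofRealCLM.comp (β i)) v = ((mulWedge β v : ℝ) : ℂ) := by
  rw [mulWedge_apply, mulWedge_apply]
  change _ = Complex.ofRealHom _
  rw [RingHom.map_det]
  rfl

theorem wedge_toAlternatingMap_smul_smul {A : Type*} [NormedCommRing A] [NormedAlgebra ℝ A]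
    {k l : ℕ} (c d : ℝ) (a : E [⋀^Fin k]→L[ℝ] A) (b : E [⋀^Fin l]→L[ℝ] A)
    (v : Fin (k + l) → E) : wedge (c • a).toAlternatingMap (d • b).toAlternatingMap v =
      (c * d) • wedge a.toAlternatingMap b.toAlternatingMap v :=
  wedge_smul_smul c d a.toAlternatingMap b.toAlternatingMap v

theorem wedge_holForm_conj (e : ℝ) (θ γ : Fin 3 → E →L[ℝ] ℝ) (v : Fin 6 → E) :
    wedge (holForm e θ γ).toAlternatingMap
        ((Complex.conjCLE : ℂ →L[ℝ] ℂ).compContinuousAlternatingMap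
          (holForm e θ γ)).toAlternatingMap v =
      8 * Complex.I * ((e ^ 2 * mulWedge (k := 6) ![θ 0, θ 1, θ 2, γ 0, γ 1, γ 2] v : ℝ) : ℂ) := by
  have hconj : (Complex.conjCLE : ℂ →L[ℝ] ℂ).compContinuousAlternatingMap (holForm e θ γ) =
      e • mulWedge (zetaForm (fun i => -θ i) γ) := by
    ext w
    simp [holForm, mulWedge_three, zetaForm_apply]
  -- The rows are the coordinates of ζ¹, ζ², ζ³ and of their conjugates γⁱ + iθⁱ in the coframe (θ,
  -- γ).
  let M : Matrix (Fin 6) (Fin 6) ℂ := !![-Complex.I, 0, 0, 1, 0, 0; 0, -Complex.I, 0, 0, 1, 0;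
    0, 0, -Complex.I, 0, 0, 1; Complex.I, 0, 0, 1, 0, 0; 0, Complex.I, 0, 0, 1, 0;
    0, 0, Complex.I, 0, 0, 1]
  have hM : M.det = 8 * Complex.I := by
    have hI3 : Complex.I ^ 3 = -Complex.I := by rw [pow_succ, Complex.I_sq]; ring
    simp [M, Matrix.det_succ_row_zero, Fin.sum_univ_succ, Fin.succAbove]
    ring_nf
    rw [hI3]
    ring
  have hwedge : wedge (mulWedge (zetaForm θ γ)).toAlternatingMap
      (mulWedge (zetaForm (fun i => -θ i) γ)).toAlternatingMap v =
      M.det * ((mulWedge (k := 6) ![θ 0, θ 1, θ 2, γ 0, γ 1, γ 2] v : ℝ) : ℂ) := by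
    have h1 : wedge (mulWedge (zetaForm θ γ)).toAlternatingMap
        (mulWedge (zetaForm (fun i => -θ i) γ)).toAlternatingMap v =
        mulWedge (k := 6) ![zetaForm θ γ 0, zetaForm θ γ 1, zetaForm θ γ 2,
          zetaForm (fun i => -θ i) γ 0, zetaForm (fun i => -θ i) γ 1,
          zetaForm (fun i => -θ i) γ 2] v := by
      rw [wedge_mulWedge_apply]
      congr 2
      ext i
      fin_cases i <;> rfl
    rw [h1, ← mulWedge_ofReal]
    refine mulWedge_sum_smul M _ _ (fun i u => ?_) v
    fin_cases i <;> simp [M, zetaForm_apply, Fin.sum_univ_six] <;> ring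
  rw [hconj, holForm, wedge_toAlternatingMap_smul_smul, hwedge, hM, Complex.real_smul]
  push_cast
  ring

end HolomorphicVolume

/-! ### Structure equations on the base and closedness of τ. -/

section StructureEquations

variable {E : Type*} [NormedAddCommGroup E] [NormedSpace ℝ E]

/-- The structure equations satisfied at `p` by the functions `yᵢ`, `ε` and the covectors
`γⁱ`, `cⁱ`. -/
structure BaseEquations (Y : Fin 3 → E → ℝ) (e : E → ℝ) (γ c : Fin 3 → E → E →L[ℝ] ℝ)
    (C : Matrix (Fin 3) (Fin 3) ℝ) (p : E) : Prop where
  e_ne : e p ≠ 0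
  e_sq : e p ^ 2 = C.det - (fun i => Y i p) ⬝ᵥ C *ᵥ (fun i => Y i p)
  C_symm : ∀ i j, C i j = C j i
  c_eq : ∀ i u, c i p u = ∑ j, C i j * γ j p u
  dY : ∀ k, HasFDerivAt (Y k) (-(3 * e p) • γ k p) p
  de : HasFDerivAt e ((4 : ℝ) • ∑ l, Y l p • c l p) p
  dγ : ∀ i, ∃ γ' : E →L[ℝ] E →L[ℝ] ℝ, HasFDerivAt (γ i) γ' p ∧ ∀ u w, γ' u w - γ' w u =
    -((e p)⁻¹ * (4 * (∑ l, Y l p * c l p u) * γ i p w - 4 * (∑ l, Y l p * c l p w) * γ i p u))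
  dc : ∀ i, ∃ c' : E →L[ℝ] E →L[ℝ] ℝ, HasFDerivAt (c i) c' p ∧ ∀ u w, c' u w - c' w u =
    -((e p)⁻¹ * (4 * (∑ l, Y l p * c l p u) * c i p w - 4 * (∑ l, Y l p * c l p w) * c i p u))

/-- The `2`-forms `τᵢ`, built from covectors. -/
noncomputable def tauOf (y : R3) (e : ℝ) (γ c : Fin 3 → E →L[ℝ] ℝ) (i : Fin 3) :
    E [⋀^Fin 2]→L[ℝ] ℝ :=
  e⁻¹ • (covectorWedge ![c (i + 1), c (i + 2)] -
    y i • ∑ k : Fin 3, y k • covectorWedge ![γ (k + 1), γ (k + 2)])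

/-- The value of `η` on a pair of vectors. -/
def etaVal (y : R3) (γ : Fin 3 → E →L[ℝ] ℝ) (u w : E) : ℝ :=
  y 0 * (γ 1 u * γ 2 w - γ 1 w * γ 2 u) + y 1 * (γ 2 u * γ 0 w - γ 2 w * γ 0 u)
    + y 2 * (γ 0 u * γ 1 w - γ 0 w * γ 1 u)

theorem tauOf_apply (y : R3) (e : ℝ) (γ c : Fin 3 → E →L[ℝ] ℝ) (i : Fin 3) (v : Fin 2 → E) :
    tauOf y e γ c i v = e⁻¹ * (c (i + 1) (v 0) * c (i + 2) (v 1) - c (i + 1) (v 1) * c (i + 2) (v 0)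
      - y i * etaVal y γ (v 0) (v 1)) := by
  simp [tauOf, covectorWedge_two, Fin.sum_univ_three, etaVal, -mul_eq_mul_left_iff]
  ring

/-- `c¹∧c²∧c³ = (det C) γ¹∧γ²∧γ³`. -/
theorem covectorWedge_three_of_matrix {γ c : Fin 3 → E →L[ℝ] ℝ} {C : Matrix (Fin 3) (Fin 3) ℝ}
    (hc : ∀ i u, c i u = ∑ j, C i j * γ j u) (v : Fin 3 → E) :
    covectorWedge c v = C.det * covectorWedge γ v :=
  mulWedge_sum_smul C γ c hc v

/-- `η∧cⁱ = (∑ₖ yₖ Cᵢₖ) γ¹∧γ²∧γ³`. -/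
theorem eta_wedge_c {γ c : Fin 3 → E →L[ℝ] ℝ} {C : Matrix (Fin 3) (Fin 3) ℝ}
    (hc : ∀ i u, c i u = ∑ j, C i j * γ j u) (y : R3) (i : Fin 3) (u v w : E) :
    etaVal y γ u v * c i w - etaVal y γ u w * c i v + etaVal y γ v w * c i u =
      (∑ k, y k * C i k) * covectorWedge γ ![u, v, w] := by
  simp [etaVal, hc, Fin.sum_univ_three, covectorWedge_three]
  ring

/-- `(∑ yₗ cˡ)∧γⁱ∧γʲ = (∑ₗ yₗ Cₗₖ) γ¹∧γ²∧γ³` for `(i, j, k)` cyclic. -/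
theorem c_wedge_gamma_gamma {γ c : Fin 3 → E →L[ℝ] ℝ} {C : Matrix (Fin 3) (Fin 3) ℝ}
    (hc : ∀ i u, c i u = ∑ j, C i j * γ j u) (y : R3) (k : Fin 3) (u v w : E) :
    (∑ l, y l * c l u) * (γ (k + 1) v * γ (k + 2) w - γ (k + 1) w * γ (k + 2) v)
      - (∑ l, y l * c l v) * (γ (k + 1) u * γ (k + 2) w - γ (k + 1) w * γ (k + 2) u)
      + (∑ l, y l * c l w) * (γ (k + 1) u * γ (k + 2) v - γ (k + 1) v * γ (k + 2) u) =
      (∑ l, y l * C l k) * covectorWedge γ ![u, v, w] := by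
  fin_cases k <;> simp [hc, Fin.sum_univ_three, covectorWedge_three] <;> ring

variable [FiniteDimensional ℝ E] {Y : Fin 3 → E → ℝ} {e : E → ℝ} {γ c : Fin 3 → E → E →L[ℝ] ℝ}
  {C : Matrix (Fin 3) (Fin 3) ℝ} {p : E}

/-- `α` is differentiable at `p`, with exterior derivative `α'`. -/
def HasExtDeriv {n : ℕ} (α : E → E [⋀^Fin n]→L[ℝ] ℝ) (α' : (Fin (n + 1) → E) → ℝ) (p : E) :
    Prop :=
  DifferentiableAt ℝ α p ∧ ∀ v, extDeriv α p v = α' v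

omit [FiniteDimensional ℝ E] in
theorem HasExtDeriv.add {n : ℕ} {α β : E → E [⋀^Fin n]→L[ℝ] ℝ} {α' β' : (Fin (n + 1) → E) → ℝ}
    {p : E} (hα : HasExtDeriv α α' p) (hβ : HasExtDeriv β β' p) :
    HasExtDeriv (fun q => α q + β q) (fun v => α' v + β' v) p :=
  ⟨hα.1.add hβ.1, fun v => by
    rw [extDeriv_fun_add hα.1 hβ.1, ContinuousAlternatingMap.add_apply, hα.2, hβ.2]⟩

omit [FiniteDimensional ℝ E] in
theorem HasExtDeriv.extDeriv_eq {n : ℕ} {α β : E → E [⋀^Fin n]→L[ℝ] ℝ}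
    {α' : (Fin (n + 1) → E) → ℝ} {p : E} (hα : HasExtDeriv α α' p) (h : ∀ q, β q = α q)
    (v : Fin (n + 1) → E) : extDeriv β p v = α' v := by
  rw [funext h, hα.2]

theorem fin_three_cases (i : Fin 3) : i = 0 ∨ i = 1 ∨ i = 2 := by
  fin_cases i <;> simp

omit [FiniteDimensional ℝ E] in
theorem HasFDerivAt.inv_real {f : E → ℝ} {f' : E →L[ℝ] ℝ} {p : E} (hf : HasFDerivAt f f' p)
    (h0 : f p ≠ 0) : HasFDerivAt (fun q => (f q)⁻¹) (-(f p ^ 2)⁻¹ • f') p :=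
  (hasDerivAt_inv h0).comp_hasFDerivAt p hf

/-- The forms `τᵢ` are closed. -/
theorem BaseEquations.extDeriv_tauOf (h : BaseEquations Y e γ c C p) (i : Fin 3) :
    extDeriv (fun q => tauOf (fun k => Y k q) (e q) (fun k => γ k q) (fun k => c k q) i) p = 0 := by
  choose γ' hγ' dγ' using h.dγ
  choose c' hc' dc' using h.dc
  have hinv := h.de.inv_real h.e_ne
  have hcc : HasExtDeriv _ _ p := extDeriv_smul_covectorWedge_two hinv (hc' (i + 1)) (hc' (i + 2))
    _ _ (dc' (i + 1)) (dc' (i + 2))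
  have hγγ : ∀ k, HasExtDeriv _ _ p := fun k : Fin 3 => extDeriv_smul_covectorWedge_two
    ((hinv.mul (h.dY i)).mul (h.dY k)).neg (hγ' (k + 1)) (hγ' (k + 2)) _ _
    (dγ' (k + 1)) (dγ' (k + 2))
  have hsum := ((hcc.add (hγγ 0)).add (hγγ 1)).add (hγγ 2)
  ext v
  rw [hsum.extDeriv_eq (fun q => by
    ext w
    simp [tauOf, Fin.sum_univ_three, -mul_eq_mul_left_iff]
    ring) v]
  have h1 := covectorWedge_three_of_matrix h.c_eq v
  have h2 := fun k => c_wedge_gamma_gamma h.c_eq (fun k => Y k p) k (v 0) (v 1) (v 2)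
  have hre : (e p)⁻¹ * e p = 1 := inv_mul_cancel₀ h.e_ne
  have hr2 : (e p ^ 2)⁻¹ = (e p)⁻¹ * (e p)⁻¹ := by rw [sq, mul_inv]
  have he2 := h.e_sq
  have h20 := h2 0
  have h21 := h2 1
  have h22 := h2 2
  simp only [Matrix.mulVec, dotProduct, Fin.sum_univ_three] at he2
  have hG := covectorWedge_three (fun k => γ k p) v
  set G := covectorWedge (fun k => γ k p) v
  rw [covectorWedge_three, hG] at h1
  simp [covectorWedge_three, Fin.sum_univ_three] at h20 h21 h22
  simp only [hr2, Fin.sum_univ_three, smul_apply, add_apply,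
    neg_apply, Pi.mul_apply, Pi.neg_apply, smul_eq_mul,
    ContinuousAlternatingMap.coe_zero, Pi.zero_apply]
  -- ε⁻¹ and the two factors c (or γ) each contribute -ε⁻¹ dε, where dε = 4 ∑ yₗ cˡ; this gives the
  -- constant 12 = 3·4. Differentiating yᵢ and the yₖ in yᵢ η gives another 12 yᵢ γ¹²³, from (1 +
  -- 3)·3. The total is -12 ε⁻² yᵢ (det C - yᵀCy - ε²) γ¹²³ = 0.
  obtain hi | hi | hi := fin_three_cases i
  all_goals
    linear_combination (norm := (simp only [hi, hG, Fin.isValue, zero_add, Fin.reduceAdd]; ring1))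
      (-12 * (e p)⁻¹ ^ 2 * Y i p) * h1 +
      12 * (e p)⁻¹ ^ 2 * Y i p * (Y 0 p * h20 + Y 1 p * h21 + Y 2 p * h22)
      + 12 * (e p)⁻¹ ^ 2 * Y i p * G * he2
      - 12 * (e p)⁻¹ * e p * Y i p * G * hre

end StructureEquations

/-! ### The nearly Kähler equations. -/

section StrictNK

variable {E : Type*} [NormedAddCommGroup E] [NormedSpace ℝ E]

theorem tauOf_pair (y : R3) (e : ℝ) (γ c : Fin 3 → E →L[ℝ] ℝ) (i : Fin 3) (u w : E) :
    tauOf y e γ c i ![u, w] = e⁻¹ * (c (i + 1) u * c (i + 2) w - c (i + 1) w * c (i + 2) u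
      - y i * etaVal y γ u w) := by
  rw [tauOf_apply]
  rfl

variable [FiniteDimensional ℝ E] {Y : Fin 3 → E → ℝ} {e : E → ℝ} {γ c θ : Fin 3 → E → E →L[ℝ] ℝ}
  {C : Matrix (Fin 3) (Fin 3) ℝ} {p : E}

/-- The equation `dω = 3 ψ⁺`. -/
theorem BaseEquations.extDeriv_fundForm (h : BaseEquations Y e γ c C p)
    (hθ : ∀ i, ∃ θ' : E →L[ℝ] E →L[ℝ] ℝ, HasFDerivAt (θ i) θ' p ∧ ∀ u w, θ' u w - θ' w u =
      4 * tauOf (fun k => Y k p) (e p) (fun k => γ k p) (fun k => c k p) i ![u, w]) :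
    extDeriv (fun q => fundForm (fun k => Y k q) (fun k => θ k q) (fun k => γ k q)
      (fun k => c k q)) p = (3 : ℝ) • realVolForm (e p) (fun k => θ k p) (fun k => γ k p) := by
  choose γ' hγ' dγ' using h.dγ
  choose c' hc' dc' using h.dc
  choose θ' hθ' dθ' using hθ
  have h1 : ∀ k, HasExtDeriv _ _ p := fun k : Fin 3 => extDeriv_smul_covectorWedge_two
    (h.dY k) (hθ' (k + 1)) (hθ' (k + 2)) _ _ (dθ' (k + 1)) (dθ' (k + 2))
  have h2 : ∀ k, HasExtDeriv _ _ p := fun k : Fin 3 => extDeriv_smul_covectorWedge_two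
    (h.dY k) (hγ' (k + 1)) (hγ' (k + 2)) _ _ (dγ' (k + 1)) (dγ' (k + 2))
  have h3 : ∀ k, HasExtDeriv _ _ p := fun k : Fin 3 => extDeriv_smul_covectorWedge_two
    (hasFDerivAt_const (1 : ℝ) p) (hθ' k) (hc' k) _ _ (dθ' k) (dc' k)
  have hsum := (((h1 0).add (h1 1)).add (h1 2)).add ((((h2 0).add (h2 1)).add (h2 2)).add
    (((h3 0).add (h3 1)).add (h3 2)))
  ext v
  rw [hsum.extDeriv_eq (fun q => by
    ext w
    simp [fundForm, Fin.sum_univ_three]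
    ring) v]
  have k1 := covectorWedge_three_of_matrix h.c_eq v
  have k2 := fun k => c_wedge_gamma_gamma h.c_eq (fun k => Y k p) k (v 0) (v 1) (v 2)
  have k3 := fun k => eta_wedge_c h.c_eq (fun k => Y k p) k (v 0) (v 1) (v 2)
  have hre : (e p)⁻¹ * e p = 1 := inv_mul_cancel₀ h.e_ne
  have he2 := h.e_sq
  have k20 := k2 0
  have k21 := k2 1
  have k22 := k2 2
  have k30 := k3 0
  have k31 := k3 1
  have k32 := k3 2
  simp only [Matrix.mulVec, dotProduct, Fin.sum_univ_three] at he2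
  have hG := covectorWedge_three (fun k => γ k p) v
  have hv : ![v 0, v 1, v 2] = v := by ext i; fin_cases i <;> rfl
  rw [covectorWedge_three] at k1
  simp only [hv, Fin.sum_univ_three, etaVal, Fin.isValue, zero_add, Fin.reduceAdd]
    at k20 k21 k22 k30 k31 k32
  simp only [realVolForm, tauOf_pair, etaVal, Fin.sum_univ_three, smul_apply,
    ContinuousAlternatingMap.smul_apply, ContinuousAlternatingMap.sub_apply,
    ContinuousAlternatingMap.add_apply, smul_eq_mul, zero_apply, Fin.isValue,
    zero_add, Fin.reduceAdd]
  set G := covectorWedge (fun k => γ k p) v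
  simp only [covectorWedge_three, Matrix.cons_val]
  -- Terms with two θ's match directly, and those with one θ cancel. The coefficient of γ¹²³ is -9ε
  -- from the dyₖ, -8ε⁻¹ yᵀCy from the dγⁱ and 4ε⁻¹ (3 det C - yᵀCy) from dθⁱ∧cⁱ, in all 12ε - 9ε =
  -- 3ε.
  linear_combination (norm := (simp only [hG]; ring1)) 12 * (e p)⁻¹ * k1
    - 8 * (e p)⁻¹ * (Y 0 p * k20 + Y 1 p * k21 + Y 2 p * k22)
    - 4 * (e p)⁻¹ * (Y 0 p * k30 + Y 1 p * k31 + Y 2 p * k32)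
    - 12 * (e p)⁻¹ * G * he2 + 12 * e p * G * hre

/-- The product of two functions of pairs of vectors, as for `2`-forms. -/
def wedgeVal (α β : E → E → ℝ) (v : Fin 4 → E) : ℝ :=
  α (v 0) (v 1) * β (v 2) (v 3) - α (v 0) (v 2) * β (v 1) (v 3) + α (v 0) (v 3) * β (v 1) (v 2)
    + α (v 1) (v 2) * β (v 0) (v 3) - α (v 1) (v 3) * β (v 0) (v 2)
    + α (v 2) (v 3) * β (v 0) (v 1)

omit [FiniteDimensional ℝ E] in
/-- `γⁱ∧γʲ∧(cⁱ∧cʲ - yₖ η) = 0`, since there are only three `γ`s. -/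
theorem gamma_gamma_wedge_tau {γ c : Fin 3 → E →L[ℝ] ℝ} {C : Matrix (Fin 3) (Fin 3) ℝ}
    (hc : ∀ i u, c i u = ∑ j, C i j * γ j u) (y : R3) (k : Fin 3) (v : Fin 4 → E) :
    wedgeVal (fun u w => γ (k + 1) u * γ (k + 2) w - γ (k + 1) w * γ (k + 2) u)
      (fun u w => c (k + 1) u * c (k + 2) w - c (k + 1) w * c (k + 2) u
        - y k * etaVal y γ u w) v = 0 := by
  fin_cases k <;> simp only [wedgeVal, hc, etaVal, Fin.sum_univ_three, Fin.isValue, Fin.zero_eta,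
    Fin.mk_one, Fin.reduceFinMk, zero_add, Fin.reduceAdd] <;> ring

set_option maxHeartbeats 1000000 in
/-- The equation `dψ⁻ = -2 ω∧ω`. -/
theorem BaseEquations.extDeriv_imagVolForm (h : BaseEquations Y e γ c C p)
    (hθ : ∀ i, ∃ θ' : E →L[ℝ] E →L[ℝ] ℝ, HasFDerivAt (θ i) θ' p ∧ ∀ u w, θ' u w - θ' w u =
      4 * tauOf (fun k => Y k p) (e p) (fun k => γ k p) (fun k => c k p) i ![u, w])
    (v : Fin 4 → E) :
    extDeriv (fun q => imagVolForm (e q) (fun k => θ k q) (fun k => γ k q)) p v =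
      -2 * wedge (fundForm (fun k => Y k p) (fun k => θ k p) (fun k => γ k p)
        (fun k => c k p)).toAlternatingMap (fundForm (fun k => Y k p) (fun k => θ k p)
        (fun k => γ k p) (fun k => c k p)).toAlternatingMap v := by
  choose γ' hγ' dγ' using h.dγ
  choose θ' hθ' dθ' using hθ
  have h1 : HasExtDeriv _ _ p := extDeriv_smul_covectorWedge_three
    h.de (hθ' 0) (hθ' 1) (hθ' 2) _ _ _ (dθ' 0) (dθ' 1) (dθ' 2)
  have h2 : ∀ k, HasExtDeriv _ _ p := fun k : Fin 3 => extDeriv_smul_covectorWedge_three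
    h.de.neg (hγ' (k + 1)) (hγ' (k + 2)) (hθ' k) _ _ _ (dγ' (k + 1)) (dγ' (k + 2)) (dθ' k)
  have hsum := h1.add (((h2 0).add (h2 1)).add (h2 2))
  rw [hsum.extDeriv_eq (fun q => by
    ext w
    simp [imagVolForm, Fin.sum_univ_three, covectorWedge_three]
    ring) v, wedge_self_fundForm]
  have hre : (e p)⁻¹ * e p = 1 := inv_mul_cancel₀ h.e_ne
  have k4 := fun k => gamma_gamma_wedge_tau h.c_eq (fun k => Y k p) k v
  -- Since C is symmetric, (∑ yₗ cˡ)∧γⁱ∧γʲ and η∧cᵏ are the same multiple of γ¹²³; the former occurs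
  -- in dψ⁻, the latter in ω∧ω.
  have k5 : ∀ k a b d, _ = _ := fun (k : Fin 3) (a b d : E) =>
    (c_wedge_gamma_gamma h.c_eq (fun k => Y k p) k a b d).trans
    ((by simp_rw [h.C_symm _ k] : _ = _).trans
      (eta_wedge_c h.c_eq (fun k => Y k p) k a b d).symm)
  have k40 := k4 0
  have k41 := k4 1
  have k42 := k4 2
  have k50 := k5 0
  have k51 := k5 1
  have k52 := k5 2
  simp only [wedgeVal, Fin.sum_univ_three, etaVal, Fin.isValue, zero_add, Fin.reduceAdd]
    at k40 k41 k42 k50 k51 k52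
  simp only [tauOf_pair, etaVal, Fin.sum_univ_three, smul_apply, add_apply, Pi.neg_apply,
    neg_apply, smul_eq_mul, Fin.isValue, zero_add, Fin.reduceAdd, covectorWedge_three,
    covectorWedge_two, Matrix.cons_val, fundForm_apply]
  let D : E → ℝ := fun u => Y 0 p * c 0 p u + Y 1 p * c 1 p u + Y 2 p * c 2 p u
  let X : Fin 3 → E → E → E → ℝ := fun k a b d =>
    D a * (γ (k + 1) p b * γ (k + 2) p d - γ (k + 1) p d * γ (k + 2) p b)
      - D b * (γ (k + 1) p a * γ (k + 2) p d - γ (k + 1) p d * γ (k + 2) p a)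
      + D d * (γ (k + 1) p a * γ (k + 2) p b - γ (k + 1) p b * γ (k + 2) p a)
  -- `S` collects the terms in which the factor ε of ψ⁻ meets the ε⁻¹ of dθ or dγ, apart from the
  -- γ∧γ∧τ terms, which vanish by `k4`. Multiplying by `hre` replaces ε⁻¹ε by 1 in them.
  let S : Fin 3 → ℝ := fun k => 4 * wedgeVal
      (fun u w => c (k + 1) p u * c (k + 2) p w - c (k + 1) p w * c (k + 2) p u
        - Y k p * etaVal (fun k => Y k p) (fun k => γ k p) u w)
      (fun u w => θ (k + 1) p u * θ (k + 2) p w - θ (k + 1) p w * θ (k + 2) p u) v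
    + 8 * (-X k (v 1) (v 2) (v 3) * θ k p (v 0) + X k (v 0) (v 2) (v 3) * θ k p (v 1)
      - X k (v 0) (v 1) (v 3) * θ k p (v 2) + X k (v 0) (v 1) (v 2) * θ k p (v 3))
  linear_combination (norm := skip)
    4 * (-θ 0 p (v 0) * k50 (v 1) (v 2) (v 3) + θ 0 p (v 1) * k50 (v 0) (v 2) (v 3)
      - θ 0 p (v 2) * k50 (v 0) (v 1) (v 3) + θ 0 p (v 3) * k50 (v 0) (v 1) (v 2))
    + 4 * (-θ 1 p (v 0) * k51 (v 1) (v 2) (v 3) + θ 1 p (v 1) * k51 (v 0) (v 2) (v 3)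
      - θ 1 p (v 2) * k51 (v 0) (v 1) (v 3) + θ 1 p (v 3) * k51 (v 0) (v 1) (v 2))
    + 4 * (-θ 2 p (v 0) * k52 (v 1) (v 2) (v 3) + θ 2 p (v 1) * k52 (v 0) (v 2) (v 3)
      - θ 2 p (v 2) * k52 (v 0) (v 1) (v 3) + θ 2 p (v 3) * k52 (v 0) (v 1) (v 2))
    - 4 * e p * (e p)⁻¹ * (k40 + k41 + k42) + (S 0 + S 1 + S 2) * hre
  simp only [S, X, D, wedgeVal, etaVal, Fin.isValue, zero_add, Fin.reduceAdd]
  ring1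

end StrictNK

/-! ### From the Monge–Ampère equation to the structure equations. -/

section Potential

theorem minSmoothness_two_le_infty : minSmoothness ℝ 2 ≤ (∞ : WithTop ℕ∞) := by
  rw [minSmoothness_of_isRCLikeNormedField]
  exact WithTop.coe_le_coe.2 (le_top : (2 : ℕ∞) ≤ ⊤)

variable {U : Set R3} {φ : R3 → ℝ} {y : R3}

theorem contDiffOn_fderiv_of_contDiffOn {F : Type*} [NormedAddCommGroup F] [NormedSpace ℝ F]
    {f : R3 → F} (hU : IsOpen U) (hf : ContDiffOn ℝ ∞ f U) : ContDiffOn ℝ ∞ (fderiv ℝ f) U :=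
  hf.fderiv_of_isOpen hU (by simp)

theorem contDiffOn_partialD (hU : IsOpen U) (hφ : ContDiffOn ℝ ∞ φ U) (i : Fin 3) :
    ContDiffOn ℝ ∞ (partialD i φ) U :=
  (contDiffOn_fderiv_of_contDiffOn hU hφ).clm_apply contDiffOn_const

theorem contDiffOn_hess (hU : IsOpen U) (hφ : ContDiffOn ℝ ∞ φ U) (i j : Fin 3) :
    ContDiffOn ℝ ∞ (fun y => hess φ y i j) U :=
  contDiffOn_partialD hU (contDiffOn_partialD hU hφ j) i

theorem contDiffOn_radialD (hU : IsOpen U) (hφ : ContDiffOn ℝ ∞ φ U) :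
    ContDiffOn ℝ ∞ (radialD φ) U :=
  ContDiffOn.sum fun i _ => (contDiff_apply ℝ ℝ i).contDiffOn.mul (contDiffOn_partialD hU hφ i)

theorem fderiv_eq_sum_partialD (f : R3 → ℝ) (y w : R3) :
    fderiv ℝ f y w = ∑ j, w j * partialD j f y := by
  conv_lhs => rw [pi_eq_sum_univ' w]
  simp [partialD, map_sum]

theorem hess_symm (hU : IsOpen U) (hφ : ContDiffOn ℝ ∞ φ U) (hy : y ∈ U) (i j : Fin 3) :
    hess φ y i j = hess φ y j i := by
  have hd : DifferentiableAt ℝ (fderiv ℝ φ) y :=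
    ((contDiffOn_fderiv_of_contDiffOn hU hφ).contDiffAt (hU.mem_nhds hy)).differentiableAt (by simp)
  have key : ∀ i j, hess φ y i j = fderiv ℝ (fderiv ℝ φ) y (Pi.single i 1) (Pi.single j 1) := by
    intro i j
    have := hd.hasFDerivAt.clm_apply (hasFDerivAt_const (Pi.single j (1 : ℝ) : R3) y)
    change fderiv ℝ (fun z => fderiv ℝ φ z (Pi.single j 1)) y (Pi.single i 1) = _
    rw [this.fderiv]
    simp
  rw [key, key]
  exact ((hφ.contDiffAt (hU.mem_nhds hy)).isSymmSndFDerivAt minSmoothness_two_le_infty) _ _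

theorem hasFDerivAt_partialD (hU : IsOpen U) (hφ : ContDiffOn ℝ ∞ φ U) (hy : y ∈ U) (i : Fin 3) :
    HasFDerivAt (partialD i φ) (fderiv ℝ (partialD i φ) y) y :=
  (((contDiffOn_partialD hU hφ i).contDiffAt (hU.mem_nhds hy)).differentiableAt
    (by simp)).hasFDerivAt

theorem hasFDerivAt_radialD (hU : IsOpen U) (hφ : ContDiffOn ℝ ∞ φ U) (hy : y ∈ U) :
    HasFDerivAt (radialD φ) (fderiv ℝ φ y + ∑ i, y i • fderiv ℝ (partialD i φ) y) y := by
  have h : HasFDerivAt (radialD φ) _ y := HasFDerivAt.fun_sum fun i _ =>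
    (hasFDerivAt_apply (𝕜 := ℝ) i y).mul (hasFDerivAt_partialD hU hφ hy i)
  refine h.congr_fderiv ?_
  ext w
  simp [fderiv_eq_sum_partialD φ, Finset.sum_add_distrib, mul_comm, add_comm]

/-- The first term comes from differentiating the coefficients yᵢ, the second from differentiating
the partial derivatives. -/
theorem radialD_radialD (hU : IsOpen U) (hφ : ContDiffOn ℝ ∞ φ U) (hy : y ∈ U) :
    radialD (radialD φ) y = radialD φ y + y ⬝ᵥ hess φ y *ᵥ y := by
  have h : ∀ j, partialD j (radialD φ) y = partialD j φ y + ∑ i, y i * hess φ y j i := by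
    intro j
    rw [partialD, (hasFDerivAt_radialD hU hφ hy).fderiv]
    simp [partialD, hess]
  simp only [radialD] at h ⊢
  simp only [h, mul_add, Finset.sum_add_distrib, dotProduct, Matrix.mulVec]
  simp [mul_comm]

/-- As for a Legendre transform, dφ cancels against ∑ ∂ᵢφ dyᵢ and only second derivatives of φ
remain. -/
theorem hasFDerivAt_sub_radialD (hU : IsOpen U) (hφ : ContDiffOn ℝ ∞ φ U) (hy : y ∈ U) :
    HasFDerivAt (fun z => φ z - radialD φ z) (-∑ i, y i • fderiv ℝ (partialD i φ) y) y := by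
  have h := ((hφ.contDiffAt (hU.mem_nhds hy)).differentiableAt (by simp)).hasFDerivAt.sub
    (hasFDerivAt_radialD hU hφ hy)
  refine h.congr_fderiv ?_
  ext w
  simp

/-- By symmetry of the Hessian, its i-th row is the gradient of ∂ᵢφ; hence cⁱ is a multiple of an
exact form. -/
theorem cForm_eq (hU : IsOpen U) (hφ : ContDiffOn ℝ ∞ φ U) (hy : y ∈ U) (i : Fin 3) :
    cForm φ i y = (-(3 * epsFun φ y)⁻¹) • fderiv ℝ (partialD i φ) y := by
  ext w
  have h : ∀ j, hess φ y i j = partialD j (partialD i φ) y := fun j => hess_symm hU hφ hy i j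
  simp [cForm, gammaForm, fderiv_eq_sum_partialD (partialD i φ), h, Finset.mul_sum]
  exact Finset.sum_congr rfl fun j _ => by ring

theorem epsFun_pos (hy : y ∈ admissibleSet U φ) : 0 < epsFun φ y :=
  Real.sqrt_pos.2 (mul_pos (by norm_num) hy.2.1)

theorem hasFDerivAt_epsFun (hU : IsOpen U) (hφ : ContDiffOn ℝ ∞ φ U)
    (hy : y ∈ admissibleSet U φ) :
    HasFDerivAt (epsFun φ) ((4 : ℝ) • ∑ l, y l • cForm φ l y) y := by
  have h := ((hasFDerivAt_sub_radialD hU hφ hy.1).const_mul (8 / 3)).sqrt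
    (mul_pos (by norm_num) hy.2.1).ne'
  have he := (epsFun_pos hy).ne'
  refine h.congr_fderiv ?_
  change (1 / (2 * epsFun φ y)) • _ = (_ : R3 →L[ℝ] ℝ)
  ext w
  simp [cForm_eq hU hφ hy.1, Finset.mul_sum]
  refine Finset.sum_congr rfl fun j _ => ?_
  field_simp
  ring

/-- The only use of the Monge–Ampère equation: -11/3 + 1 = -8/3 makes the lower-order terms equal to
ε². -/
theorem epsFun_sq (hU : IsOpen U) (hφ : ContDiffOn ℝ ∞ φ U) (hMA : SolvesMA U φ)
    (hy : y ∈ admissibleSet U φ) :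
    epsFun φ y ^ 2 = (hess φ y).det - y ⬝ᵥ hess φ y *ᵥ y := by
  rw [epsFun, Real.sq_sqrt (mul_pos (by norm_num) hy.2.1).le, hMA y hy.1,
    radialD_radialD hU hφ hy.1]
  ring

/-- Covector fields `-(3ε)⁻¹ β` with `β` closed. -/
theorem exists_hasFDerivAt_scaled {e : R3 → ℝ} {e' : R3 →L[ℝ] ℝ} {β : R3 → R3 →L[ℝ] ℝ}
    {β' : R3 →L[ℝ] R3 →L[ℝ] ℝ} (he : HasFDerivAt e e' y) (h0 : e y ≠ 0) (hβ : HasFDerivAt β β' y)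
    (hsymm : ∀ u w, β' u w = β' w u) :
    ∃ γ' : R3 →L[ℝ] R3 →L[ℝ] ℝ, HasFDerivAt (fun z => (-(3 * e z)⁻¹) • β z) γ' y ∧
      ∀ u w, γ' u w - γ' w u = -((e y)⁻¹ * (e' u * ((-(3 * e y)⁻¹) • β y) w
        - e' w * ((-(3 * e y)⁻¹) • β y) u)) := by
  have hs : HasFDerivAt (fun z => -(3 * e z)⁻¹) ((3 * e y ^ 2)⁻¹ • e') y := by
    have := ((he.const_mul 3).inv_real (mul_ne_zero (by norm_num) h0)).neg
    refine this.congr_fderiv ?_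
    ext w
    simp
    field_simp
  refine ⟨_, hs.smul hβ, fun u w => ?_⟩
  simp [hsymm u w]
  field_simp
  ring

/-- The equations for γ and c are one computation, applied to -(3ε)⁻¹ dyᵢ and -(3ε)⁻¹ d(∂ᵢφ). -/
theorem baseEquations (hU : IsOpen U) (hφ : ContDiffOn ℝ ∞ φ U) (hMA : SolvesMA U φ)
    (hy : y ∈ admissibleSet U φ) :
    BaseEquations (fun k z => z k) (epsFun φ) (gammaForm φ) (cForm φ) (hess φ y) y := by
  have he := (epsFun_pos hy).ne'
  have hD := hasFDerivAt_epsFun hU hφ hy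
  refine ⟨he, epsFun_sq hU hφ hMA hy, hess_symm hU hφ hy.1, fun i u => by simp [cForm],
    fun k => ?_, hD, fun i => ?_, fun i => ?_⟩
  · refine (hasFDerivAt_apply (𝕜 := ℝ) k y).congr_fderiv ?_
    ext w
    simp [gammaForm]
    field_simp
  · obtain ⟨γ', h1, h2⟩ := exists_hasFDerivAt_scaled hD he
      (hasFDerivAt_const (ContinuousLinearMap.proj (R := ℝ) (φ := fun _ : Fin 3 => ℝ) i) y)
      (fun u w => rfl)
    refine ⟨γ', h1, fun u w => ?_⟩
    rw [h2]
    simp [gammaForm]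
  · have hd : DifferentiableAt ℝ (fderiv ℝ (partialD i φ)) y :=
      ((contDiffOn_fderiv_of_contDiffOn hU (contDiffOn_partialD hU hφ i)).contDiffAt
        (hU.mem_nhds hy.1)).differentiableAt (by simp)
    obtain ⟨c', h1, h2⟩ := exists_hasFDerivAt_scaled hD he hd.hasFDerivAt
      (((contDiffOn_partialD hU hφ i).contDiffAt (hU.mem_nhds hy.1)).isSymmSndFDerivAt
        minSmoothness_two_le_infty)
    refine ⟨c', h1.congr_of_eventuallyEq ?_, fun u w => ?_⟩
    · filter_upwards [hU.mem_nhds hy.1] with z hz using cForm_eq hU hφ hz i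
    · rw [h2, cForm_eq hU hφ hy.1 i]
      simp

theorem tauForm_eq (φ : R3 → ℝ) (i : Fin 3) : tauForm φ i = fun y =>
    tauOf (fun k => y k) (epsFun φ y) (fun k => gammaForm φ k y) (fun k => cForm φ k y) i := rfl

theorem extDeriv_tauForm (hU : IsOpen U) (hφ : ContDiffOn ℝ ∞ φ U) (hMA : SolvesMA U φ)
    (hy : y ∈ admissibleSet U φ) (i : Fin 3) : extDeriv (tauForm φ i) y = 0 :=
  (baseEquations hU hφ hMA hy).extDeriv_tauOf i

end Potential

/-! ### Openness of U₀. -/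

section Openness

variable {U : Set R3} {φ : R3 → ℝ} {y : R3}

theorem bigMatrix_isHermitian (hU : IsOpen U) (hφ : ContDiffOn ℝ ∞ φ U) (hy : y ∈ U) :
    (bigMatrix φ y).IsHermitian := by
  have hC : (hess φ y).transpose = hess φ y := by
    ext i j
    exact hess_symm hU hφ hy j i
  have hm : (muMatrix y).transpose = -muMatrix y := by
    ext i j
    fin_cases i <;> fin_cases j <;> simp [muMatrix]
  rw [Matrix.IsHermitian, bigMatrix, Matrix.fromBlocks_conjTranspose]
  simp [Matrix.conjTranspose_eq_transpose_of_trivial, hC, hm]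

theorem continuousOn_quadForm_bigMatrix (hU : IsOpen U) (hφ : ContDiffOn ℝ ∞ φ U) :
    ContinuousOn (fun z : R3 × (Fin 3 ⊕ Fin 3 → ℝ) => z.2 ⬝ᵥ bigMatrix φ z.1 *ᵥ z.2)
      (U ×ˢ univ) := by
  have hD : ∀ i j, ContinuousOn (fun z : R3 × (Fin 3 ⊕ Fin 3 → ℝ) => bigMatrix φ z.1 i j)
      (U ×ˢ univ) := by
    intro i j
    have h : ContinuousOn (fun y => bigMatrix φ y i j) U := by
      have hC := fun i j => (contDiffOn_hess hU hφ i j).continuousOn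
      have hm : ∀ i j, ContinuousOn (fun y => muMatrix y i j) U := fun i j => by
        fin_cases i <;> fin_cases j <;> simp [muMatrix] <;> fun_prop
      rcases i with i | i <;> rcases j with j | j
      exacts [hC i j, (hm i j).neg, hm i j, hC i j]
    exact h.comp continuousOn_fst fun z hz => hz.1
  simp only [dotProduct, Matrix.mulVec]
  refine continuousOn_finsetSum _ fun i _ => ContinuousOn.mul (by fun_prop) ?_
  exact continuousOn_finsetSum _ fun j _ => (hD i j).mul (by fun_prop)

/-- Positivity of the quadratic form need only be tested on the unit sphere. By compactness and
joint continuity it persists there for all nearby points, and homogeneity extends it to all nonzero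
vectors. -/
theorem isOpen_admissibleSet (hU : IsOpen U) (hφ : ContDiffOn ℝ ∞ φ U) :
    IsOpen (admissibleSet U φ) := by
  rw [isOpen_iff_mem_nhds]
  rintro y ⟨hy, hpos, hD⟩
  have h1 := hU.mem_nhds hy
  have h2 : ∀ᶠ z in nhds y, 0 < φ z - radialD φ z :=
    ((hφ.continuousOn.continuousAt h1).sub
      ((contDiffOn_radialD hU hφ).continuousOn.continuousAt h1)).eventually_const_lt hpos
  have h3 : ∀ᶠ z in nhds y, ∀ x ∈ Metric.sphere (0 : Fin 3 ⊕ Fin 3 → ℝ) 1,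
      0 < x ⬝ᵥ bigMatrix φ z *ᵥ x := by
    refine (isCompact_sphere _ _).eventually_forall_of_forall_eventually
      (P := fun z x => 0 < x ⬝ᵥ bigMatrix φ z *ᵥ x) fun x hx => ?_
    refine ((continuousOn_quadForm_bigMatrix hU hφ).continuousAt
      ((hU.prod isOpen_univ).mem_nhds ⟨hy, mem_univ x⟩)).eventually_const_lt ?_
    have hx0 : x ≠ 0 := by
      rintro rfl
      simp at hx
    simpa using hD.dotProduct_mulVec_pos hx0
  filter_upwards [h1, h2, h3] with z hz1 hz2 hz3
  refine ⟨hz1, hz2, .of_dotProduct_mulVec_pos (bigMatrix_isHermitian hU hφ hz1) fun x hx => ?_⟩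
  have hn : 0 < ‖x‖ := norm_pos_iff.2 hx
  have hs := hz3 (‖x‖⁻¹ • x) (by simp [norm_smul, hn.ne'])
  have hxs : x = ‖x‖ • (‖x‖⁻¹ • x) := by rw [smul_smul, mul_inv_cancel₀ hn.ne', one_smul]
  rw [star_trivial, hxs, Matrix.mulVec_smul, smul_dotProduct, dotProduct_smul, smul_eq_mul,
    smul_eq_mul]
  positivity

end Openness

/-! ### Smooth dependence of integrals on parameters. -/

section ParametricIntegral

variable {H F : Type} [NormedAddCommGroup H] [NormedSpace ℝ H]
  [NormedAddCommGroup F] [NormedSpace ℝ F]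

theorem hasFDerivAt_integral_of_contDiffOn {f : ℝ × H → F} {Ω : Set (ℝ × H)} (hΩ : IsOpen Ω)
    (hf : ContDiffOn ℝ 1 f Ω) {y : H} (hy : ∀ t ∈ Icc (0 : ℝ) 1, (t, y) ∈ Ω) :
    HasFDerivAt (fun z => ∫ t in (0 : ℝ)..1, f (t, z))
      (∫ t in (0 : ℝ)..1, (fderiv ℝ f (t, y)).comp (ContinuousLinearMap.inr ℝ ℝ H)) y := by
  let f' : H → ℝ → H →L[ℝ] F := fun z t =>
    (fderiv ℝ f (t, z)).comp (ContinuousLinearMap.inr ℝ ℝ H)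
  have hf' : ContinuousOn (fun q : ℝ × H => f' q.2 q.1) Ω :=
    (hf.continuousOn_fderiv_of_isOpen hΩ le_rfl).clm_comp continuousOn_const
  have hcurve : ∀ z : H, ContinuousOn (fun t : ℝ => (t, z)) (Icc (0 : ℝ) 1) := fun z =>
    continuousOn_id.prodMk continuousOn_const
  obtain ⟨M, hM⟩ := (isCompact_Icc (a := (0 : ℝ)) (b := 1)).exists_bound_of_continuousOn
    (hf'.comp (hcurve y) hy)
  -- Compactness of [0, 1] yields one neighbourhood of y serving all t; the constant M + 1 is then
  -- the integrable bound for differentiation under the integral.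
  have hs : ∀ᶠ z in nhds y, ∀ t ∈ Icc (0 : ℝ) 1, (t, z) ∈ Ω ∧ ‖f' z t‖ ≤ M + 1 := by
    refine isCompact_Icc.eventually_forall_of_forall_eventually
      (P := fun z t => (t, z) ∈ Ω ∧ ‖f' z t‖ ≤ M + 1) fun t ht => ?_
    have hswap : Filter.Tendsto (fun q : H × ℝ => (q.2, q.1)) (nhds (y, t)) (nhds (t, y)) :=
      continuous_swap.tendsto _
    have h1 : ∀ᶠ q in nhds (t, y), ‖f' q.2 q.1‖ < M + 1 :=
      (hf'.continuousAt (hΩ.mem_nhds (hy t ht))).norm.eventually_lt_const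
        ((hM t ht).trans_lt (by linarith))
    filter_upwards [hswap.eventually (hΩ.mem_nhds (hy t ht)), hswap.eventually h1] with q hq1 hq2
    exact ⟨hq1, hq2.le⟩
  have hint : ∀ z, (∀ t ∈ Icc (0 : ℝ) 1, (t, z) ∈ Ω) →
      IntervalIntegrable (fun t => f (t, z)) MeasureTheory.volume 0 1 := fun z hz =>
    (hf.continuousOn.comp (hcurve z) hz).intervalIntegrable_of_Icc zero_le_one
  refine intervalIntegral.hasFDerivAt_integral_of_dominated_of_fderiv_le
    (F := fun z t => f (t, z)) (F' := f') (bound := fun _ => M + 1) hs ?_ (hint y hy) ?_ ?_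
    intervalIntegrable_const ?_
  · filter_upwards [hs] with z hz
    exact (hint z fun t ht => (hz t ht).1).def'.aestronglyMeasurable
  · exact ((hf'.comp (hcurve y) hy).intervalIntegrable_of_Icc
      zero_le_one).def'.aestronglyMeasurable
  · refine Filter.Eventually.of_forall fun t ht z hz => (hz t ?_).2
    rw [uIoc_of_le zero_le_one] at ht
    exact Ioc_subset_Icc_self ht
  · refine Filter.Eventually.of_forall fun t ht z hz => ?_
    rw [uIoc_of_le zero_le_one] at ht
    have h1 := ((hf.contDiffAt (hΩ.mem_nhds (hz t (Ioc_subset_Icc_self ht)).1)).differentiableAt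
      (by simp)).hasFDerivAt
    exact h1.comp z (hasFDerivAt_prodMk_right t z)

/-- Induction on n: the derivative is an integral of the same kind, with values in `H →L[ℝ] F`, so
the target must vary in the induction. -/
theorem contDiffOn_integral {n : ℕ} : ∀ {F : Type} [NormedAddCommGroup F] [NormedSpace ℝ F]
    {f : ℝ × H → F} {Ω : Set (ℝ × H)} {W : Set H}, IsOpen Ω → IsOpen W →
    ContDiffOn ℝ ∞ f Ω → (∀ y ∈ W, ∀ t ∈ Icc (0 : ℝ) 1, (t, y) ∈ Ω) →
    ContDiffOn ℝ n (fun z => ∫ t in (0 : ℝ)..1, f (t, z)) W := by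
  induction n with
  | zero =>
    intro F _ _ f Ω W hΩ hW hf h
    refine contDiffOn_zero.2 fun y hy => ?_
    exact (hasFDerivAt_integral_of_contDiffOn hΩ (hf.of_le (by simp))
      (h y hy)).continuousAt.continuousWithinAt
  | succ n ih =>
    intro F _ _ f Ω W hΩ hW hf h
    have hd := fun y hy => hasFDerivAt_integral_of_contDiffOn hΩ (hf.of_le (by simp)) (h y hy)
    push_cast
    rw [contDiffOn_succ_iff_fderiv_of_isOpen hW]
    refine ⟨fun y hy => (hd y hy).differentiableAt.differentiableWithinAt, by simp, ?_⟩
    refine ContDiffOn.congr (f := fun z => ∫ t in (0 : ℝ)..1,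
      (fderiv ℝ f (t, z)).comp (ContinuousLinearMap.inr ℝ ℝ H)) ?_ fun y hy => (hd y hy).fderiv
    exact ih (f := fun q => (fderiv ℝ f q).comp (ContinuousLinearMap.inr ℝ ℝ H)) hΩ hW
      ((hf.fderiv_of_isOpen hΩ (by simp)).clm_comp contDiffOn_const) h

end ParametricIntegral

/-! ### The Poincaré lemma for 2-forms. -/

section Poincare

variable {W : Set R3}

/-- A `2`-form as a bilinear map. -/
noncomputable def bilinOf (β : R3 [⋀^Fin 2]→L[ℝ] ℝ) : R3 →L[ℝ] R3 →L[ℝ] ℝ :=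
  LinearMap.toContinuousLinearMap
    { toFun := fun u => (ContinuousAlternatingMap.ofSubsingleton ℝ R3 ℝ (0 : Fin 1)).symm
        (β.curryLeft u)
      map_add' := fun u w => by ext; simp
      map_smul' := fun t u => by ext; simp }

theorem bilinOf_apply (β : R3 [⋀^Fin 2]→L[ℝ] ℝ) (u w : R3) : bilinOf β u w = β ![u, w] := by
  have h : (Matrix.vecCons u fun _ : Fin 1 => w) = ![u, w] := by
    ext i; fin_cases i <;> rfl
  simp [bilinOf, ← h]

set_option maxSynthPendingDepth 3 in
/-- The Poincaré lemma for `2`-forms on convex open subsets. -/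
theorem exists_primitive_of_closed_two_form (hW : IsOpen W) (hc : Convex ℝ W)
    {β : R3 → R3 [⋀^Fin 2]→L[ℝ] ℝ} (hβ : ContDiffOn ℝ ∞ β W) (hd : ∀ y ∈ W, extDeriv β y = 0) :
    ∃ α : R3 → R3 →L[ℝ] ℝ, ContDiffOn ℝ ∞ α W ∧
      ∀ y ∈ W, extDeriv (fun z => oneForm (α z)) y = β y := by
  obtain rfl | ⟨a, ha⟩ := W.eq_empty_or_nonempty
  · exact ⟨0, contDiffOn_const, by simp⟩
  obtain ⟨B, hBβ⟩ : ∃ B : R3 → R3 →L[ℝ] R3 →L[ℝ] ℝ, ∀ y u w, B y u w = β y ![u, w] :=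
    ⟨fun y => bilinOf (β y), fun y => bilinOf_apply (β y)⟩
  have hB : ContDiffOn ℝ ∞ B W := by
    refine contDiffOn_clm_apply.2 fun u => contDiffOn_clm_apply.2 fun w => ?_
    simp only [hBβ]
    exact (ContinuousAlternatingMap.apply ℝ R3 ℝ ![u, w]).contDiff.comp_contDiffOn hβ
  have hBd : ∀ y ∈ W, HasFDerivAt B (fderiv ℝ B y) y := fun y hy =>
    ((hB.contDiffAt (hW.mem_nhds hy)).differentiableAt (by simp)).hasFDerivAt
  have hanti : ∀ y u w, B y u w = -B y w u := by
    intro y u w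
    have h : β y (![w, u] ∘ Equiv.swap 0 1) = -β y ![w, u] :=
      (β y).toAlternatingMap.map_swap _ (by decide)
    have e : ![w, u] ∘ Equiv.swap 0 1 = ![u, w] := by ext i; fin_cases i <;> rfl
    simp only [hBβ]
    rw [← h, e]
  have hfd : ∀ y ∈ W, ∀ u w, HasFDerivAt (fun z => β z ![u, w])
      (((fderiv ℝ B y).flip u).flip w) y := by
    intro y hy u w
    have h := (hBd y hy).clm_apply (hasFDerivAt_const u y)
    have h2 := h.clm_apply (hasFDerivAt_const w y)
    simp only [hBβ] at h2
    refine h2.congr_fderiv ?_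
    ext p
    simp
  have hanti' : ∀ y ∈ W, ∀ p u w, fderiv ℝ B y p u w = -fderiv ℝ B y p w u := by
    intro y hy p u w
    have h1 := hfd y hy u w
    have h2 := (hfd y hy w u).neg
    have h3 : (fun z => β z ![u, w]) = -fun z => β z ![w, u] := by
      ext z
      simpa only [hBβ, Pi.neg_apply] using hanti z u w
    rw [h3] at h1
    simpa using DFunLike.congr_fun (h1.unique h2) p
  have hclosed : ∀ y ∈ W, ∀ u x w, fderiv ℝ B y u x w - fderiv ℝ B y x u w
      + fderiv ℝ B y w u x = 0 := by
    intro y hy u x w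
    have h := DFunLike.congr_fun (hd y hy) ![u, x, w]
    rw [extDeriv_apply ((hβ.contDiffAt (hW.mem_nhds hy)).differentiableAt (by simp))] at h
    have h := (Fin.sum_univ_three _).symm.trans h
    have r0 : Fin.removeNth 0 ![u, x, w] = ![x, w] := by ext i; fin_cases i <;> rfl
    have r1 : Fin.removeNth 1 ![u, x, w] = ![u, w] := by ext i; fin_cases i <;> rfl
    have r2 : Fin.removeNth 2 ![u, x, w] = ![u, x] := by ext i; fin_cases i <;> rfl
    rw [r0, r1, r2, (hfd y hy x w).fderiv, (hfd y hy u w).fderiv,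
      (hfd y hy u x).fderiv] at h
    simpa [sub_eq_add_neg] using h
  -- Homotopy operator of the contraction to a: α at y is the integral over t ∈ [0, 1] of t β(y - a,
  -- ·), with β taken at c(t, y).
  let c : ℝ × R3 → R3 := fun q => a + q.1 • (q.2 - a)
  have hcc : ContDiff ℝ ∞ c := by fun_prop
  let Ω : Set (ℝ × R3) := c ⁻¹' W
  have hΩ : IsOpen Ω := hW.preimage hcc.continuous
  have hmem : ∀ y ∈ W, ∀ t ∈ Icc (0 : ℝ) 1, (t, y) ∈ Ω := fun y hy t ht =>
    hc.add_smul_sub_mem ha hy ht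
  let f : ℝ × R3 → R3 →L[ℝ] ℝ := fun q => q.1 • B (c q) (q.2 - a)
  have hf : ContDiffOn ℝ ∞ f Ω :=
    contDiffOn_fst.smul ((hB.comp hcc.contDiffOn fun q hq => hq).clm_apply (by fun_prop))
  refine ⟨fun y => ∫ t in (0 : ℝ)..1, f (t, y), contDiffOn_infty.2 fun n =>
    contDiffOn_integral hΩ hW hf hmem, fun y hy => ?_⟩
  have hder := hasFDerivAt_integral_of_contDiffOn hΩ (hf.of_le (by simp)) (hmem y hy)
  let f' : ℝ → R3 →L[ℝ] R3 →L[ℝ] ℝ := fun t =>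
    (fderiv ℝ f (t, y)).comp (ContinuousLinearMap.inr ℝ ℝ R3)
  have hf' : ContinuousOn f' (Icc 0 1) :=
    ((hf.continuousOn_fderiv_of_isOpen hΩ (by simp)).comp
      (continuousOn_id.prodMk continuousOn_const) (hmem y hy)).clm_comp continuousOn_const
  have hval : ∀ t ∈ Icc (0 : ℝ) 1, ∀ u w, f' t u w =
      t * (t * fderiv ℝ B (c (t, y)) u (y - a) w + B (c (t, y)) u w) := by
    intro t ht u w
    have hsm : HasFDerivAt (fun z => f (t, z)) (f' t) y :=
      ((hf.contDiffAt (hΩ.mem_nhds (hmem y hy t ht))).differentiableAt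
        (by simp)).hasFDerivAt.comp y (hasFDerivAt_prodMk_right t y)
    have hsub : HasFDerivAt (fun z : R3 => z - a) (ContinuousLinearMap.id ℝ R3) y :=
      (hasFDerivAt_id y).sub_const a
    have hc' : HasFDerivAt (fun z => c (t, z)) (t • ContinuousLinearMap.id ℝ R3) y :=
      (hsub.const_smul t).const_add a
    have h2 := (((hBd _ (hmem y hy t ht)).comp y hc').clm_apply hsub).const_smul t
    rw [hsm.unique h2]
    simp
    ring
  ext v
  rw [extDeriv_oneForm_apply hder]
  have hv : v = ![v 0, v 1] := by ext i; fin_cases i <;> rfl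
  rw [hv]
  generalize v 0 = u
  generalize v 1 = w
  let L : (R3 →L[ℝ] R3 →L[ℝ] ℝ) →L[ℝ] ℝ :=
    (ContinuousLinearMap.apply ℝ ℝ w).comp (ContinuousLinearMap.apply ℝ (R3 →L[ℝ] ℝ) u)
      - (ContinuousLinearMap.apply ℝ ℝ u).comp (ContinuousLinearMap.apply ℝ (R3 →L[ℝ] ℝ) w)
  have hint : IntervalIntegrable f' MeasureTheory.volume 0 1 :=
    hf'.intervalIntegrable_of_Icc zero_le_one
  change L (∫ t in (0 : ℝ)..1, f' t) = β y ![u, w]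
  rw [← L.intervalIntegral_comp_comm hint]
  -- By closedness, the integrand of dα(u, w) is the t-derivative of t² β(u, w) along the segment,
  -- which is 0 at t = 0 and β at y for t = 1.
  have hprim : ∀ t ∈ uIcc (0 : ℝ) 1,
      HasDerivAt (fun t => t ^ 2 * B (c (t, y)) u w) (L (f' t)) t := by
    intro t ht
    rw [uIcc_of_le zero_le_one] at ht
    have hct : HasDerivAt (fun t => c (t, y)) (y - a) t := by
      simpa [c] using ((hasDerivAt_id t).smul_const (y - a)).const_add a
    have h1 := ((hfd _ (hmem y hy t ht) u w).comp_hasDerivAt t hct)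
    have h2 := ((hasDerivAt_id t).pow 2).mul h1
    simp only [hBβ]
    refine h2.congr_deriv ?_
    have e1 := hclosed _ (hmem y hy t ht) u (y - a) w
    have e2 := hanti' _ (hmem y hy t ht) w u (y - a)
    have e3 := hanti (c (t, y)) w u
    simp only [L, sub_apply, ContinuousLinearMap.comp_apply,
      ContinuousLinearMap.apply_apply, hval t ht]
    simp only [← hBβ]
    simp [-map_sub]
    linear_combination (-t ^ 2) * e1 + t ^ 2 * e2 + t * e3
  rw [intervalIntegral.integral_eq_sub_of_hasDerivAt hprim
    ((L.continuous.comp_continuousOn hf').intervalIntegrable_of_Icc zero_le_one)]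
  simp [hBβ, c]

end Poincare

/-! ### Smoothness of the data and their pull-back to W × T³. -/

section Smoothness

variable {U W : Set R3} {φ : R3 → ℝ} {y : R3} {σ : Fin 3 → R3 → R3 →L[ℝ] ℝ}

theorem admissibleSet_subset : admissibleSet U φ ⊆ U := fun _ h => h.1

theorem contDiffOn_epsFun (hU : IsOpen U) (hφ : ContDiffOn ℝ ∞ φ U) :
    ContDiffOn ℝ ∞ (epsFun φ) (admissibleSet U φ) :=
  ((contDiffOn_const.mul (hφ.sub (contDiffOn_radialD hU hφ))).mono admissibleSet_subset).sqrt
    fun _ hy => (mul_pos (by norm_num) hy.2.1).ne'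

theorem contDiffOn_gammaForm (hU : IsOpen U) (hφ : ContDiffOn ℝ ∞ φ U) (i : Fin 3) :
    ContDiffOn ℝ ∞ (gammaForm φ i) (admissibleSet U φ) :=
  ((contDiffOn_const.mul (contDiffOn_epsFun hU hφ)).inv
    fun _ hy => mul_ne_zero (by norm_num) (epsFun_pos hy).ne').neg.smul contDiffOn_const

theorem contDiffOn_cForm (hU : IsOpen U) (hφ : ContDiffOn ℝ ∞ φ U) (i : Fin 3) :
    ContDiffOn ℝ ∞ (cForm φ i) (admissibleSet U φ) :=
  ContDiffOn.sum fun j _ => ((contDiffOn_hess hU hφ i j).mono admissibleSet_subset).smul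
    (contDiffOn_gammaForm hU hφ j)

theorem contDiffOn_tauForm (hU : IsOpen U) (hφ : ContDiffOn ℝ ∞ φ U) (i : Fin 3) :
    ContDiffOn ℝ ∞ (tauForm φ i) (admissibleSet U φ) := by
  have hγ := fun j (u : R3) =>
    (contDiffOn_gammaForm hU hφ j).clm_apply (contDiffOn_const (c := u))
  have hc := fun j (u : R3) => (contDiffOn_cForm hU hφ j).clm_apply (contDiffOn_const (c := u))
  have hy := fun j : Fin 3 =>
    (contDiff_apply ℝ ℝ j : ContDiff ℝ ∞ fun y : R3 => y j).contDiffOn (s := admissibleSet U φ)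
  refine contDiffOn_alternating_of_apply fun v => ?_
  simp only [tauForm_eq, tauOf_apply, etaVal]
  exact ((contDiffOn_epsFun hU hφ).inv fun _ hy => (epsFun_pos hy).ne').mul
    ((((hc _ _).mul (hc _ _)).sub ((hc _ _).mul (hc _ _))).sub ((hy _).mul
    ((((hy _).mul (((hγ _ _).mul (hγ _ _)).sub ((hγ _ _).mul (hγ _ _)))).add
      ((hy _).mul (((hγ _ _).mul (hγ _ _)).sub ((hγ _ _).mul (hγ _ _))))).add
      ((hy _).mul (((hγ _ _).mul (hγ _ _)).sub ((hγ _ _).mul (hγ _ _)))))))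

/-- Pull-back along the projection `Tan → R3`, as a continuous linear map on covectors. -/
theorem basic_eq (a : R3 →L[ℝ] ℝ) : basic a =
    (ContinuousLinearMap.compL ℝ Tan R3 ℝ).flip (ContinuousLinearMap.fst ℝ R3 R3) a := rfl

theorem basic_apply (a : R3 →L[ℝ] ℝ) (u : Tan) : basic a u = a u.1 := rfl

theorem thetaForm_apply (i : Fin 3) (u : Tan) : thetaForm σ i y u = u.2 i + σ i y u.1 := rfl

theorem ContDiffOn.basic {a : R3 → R3 →L[ℝ] ℝ} (ha : ContDiffOn ℝ ∞ a W) :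
    ContDiffOn ℝ ∞ (fun y => basic (a y)) W := by
  simp only [basic_eq]
  exact ContinuousLinearMap.contDiff _ |>.comp_contDiffOn ha

theorem contDiffOn_thetaForm (hσ : IsPotential φ W σ) (i : Fin 3) :
    ContDiffOn ℝ ∞ (thetaForm σ i) W :=
  contDiffOn_const.add (hσ i).1.basic

theorem smoothOver_of_base {F : Type*} [NormedAddCommGroup F] [NormedSpace ℝ F] {T : R3 → F}
    (hT : ContDiffOn ℝ ∞ T W) : SmoothOver W fun q => T q.1 :=
  hT.comp contDiff_fst.contDiffOn fun _ hp => hp.1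

theorem fderiv_lift_base {F : Type*} [NormedAddCommGroup F] [NormedSpace ℝ F] {T : R3 → F}
    (hW : IsOpen W) (hT : ContDiffOn ℝ ∞ T W) {p : Tan} (hp : p.1 ∈ W) (ξ : R3) :
    fderiv ℝ (lift fun q => T q.1) p (0, ξ) = 0 := by
  have hd := ((hT.contDiffAt (hW.mem_nhds hp)).differentiableAt (by simp)).hasFDerivAt.comp p
    (hasFDerivAt_fst (𝕜 := ℝ))
  change fderiv ℝ (T ∘ Prod.fst) p (0, ξ) = 0
  rw [hd.fderiv]
  simp

theorem hasFDerivAt_basic {a : R3 → R3 →L[ℝ] ℝ} {a' : R3 →L[ℝ] R3 →L[ℝ] ℝ} {p : Tan}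
    (ha : HasFDerivAt a a' p.1) : ∃ A : Tan →L[ℝ] Tan →L[ℝ] ℝ,
      HasFDerivAt (fun q : Tan => basic (a q.1)) A p ∧ ∀ u w, A u w = a' u.1 w.1 := by
  have h := (((ContinuousLinearMap.compL ℝ Tan R3 ℝ).flip
    (ContinuousLinearMap.fst ℝ R3 R3)).hasFDerivAt (x := a p.1)).comp p
    (ha.comp p (hasFDerivAt_fst (𝕜 := ℝ)))
  exact ⟨_, h, fun u w => rfl⟩

/-- The structure equations, pulled back to `Tan`. -/
theorem BaseEquations.pullback {e : R3 → ℝ} {γ c : Fin 3 → R3 → R3 →L[ℝ] ℝ}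
    {C : Matrix (Fin 3) (Fin 3) ℝ} {p : Tan}
    (h : BaseEquations (fun k z => z k) e γ c C p.1) :
    BaseEquations (fun k (q : Tan) => q.1 k) (fun q => e q.1) (fun i q => basic (γ i q.1))
      (fun i q => basic (c i q.1)) C p := by
  refine ⟨h.e_ne, h.e_sq, h.C_symm, fun i u => h.c_eq i u.1, fun k => ?_, ?_, fun i => ?_,
    fun i => ?_⟩
  · exact ((h.dY k).comp p (hasFDerivAt_fst (𝕜 := ℝ))).congr_fderiv (by ext u <;> simp [basic])
  · exact (h.de.comp p (hasFDerivAt_fst (𝕜 := ℝ))).congr_fderiv (by ext u <;> simp [basic])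
  · obtain ⟨γ', h1, h2⟩ := h.dγ i
    obtain ⟨A, hA, hA'⟩ := hasFDerivAt_basic h1
    exact ⟨A, hA, fun u w => by rw [hA', hA', h2]; rfl⟩
  · obtain ⟨c', h1, h2⟩ := h.dc i
    obtain ⟨A, hA, hA'⟩ := hasFDerivAt_basic h1
    exact ⟨A, hA, fun u w => by rw [hA', hA', h2]; rfl⟩

/-- dxᵢ has constant coefficients, so dθⁱ is the pull-back of dσᵢ. -/
theorem hasFDerivAt_thetaForm (hW : IsOpen W) (hσ : IsPotential φ W σ) {p : Tan} (hp : p.1 ∈ W)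
    (i : Fin 3) : ∃ θ' : Tan →L[ℝ] Tan →L[ℝ] ℝ,
      HasFDerivAt (fun q : Tan => thetaForm σ i q.1) θ' p ∧ ∀ u w, θ' u w - θ' w u =
        4 * tauOf p.1 (epsFun φ p.1) (fun k => basic (gammaForm φ k p.1))
          (fun k => basic (cForm φ k p.1)) i ![u, w] := by
  have hd := (((hσ i).1.contDiffAt (hW.mem_nhds hp)).differentiableAt (by simp)).hasFDerivAt
  obtain ⟨A, hA, hA'⟩ := hasFDerivAt_basic hd
  refine ⟨A, (hA.const_add ((ContinuousLinearMap.proj i).comp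
    (ContinuousLinearMap.snd ℝ R3 R3))), fun u w => ?_⟩
  have h := DFunLike.congr_fun ((hσ i).2 p.1 hp) ![u.1, w.1]
  rw [extDeriv_oneForm_apply hd] at h
  rw [hA', hA']
  refine h.trans ?_
  simp [tauForm_eq, tauOf_apply, etaVal, basic_apply]

end Smoothness

/-! ### The SU(3)-structure, its uniqueness and its symmetries. -/

section ToricStructure

variable {U W : Set R3} {φ : R3 → ℝ} {y : R3} {σ : Fin 3 → R3 → R3 →L[ℝ] ℝ}

/-- The vectors dual to `γ¹, γ², γ³` in the frame dual to the coframe `(γ, θ)`. -/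
noncomputable def gammaVec (φ : R3 → ℝ) (σ : Fin 3 → R3 → R3 →L[ℝ] ℝ) (i : Fin 3) (y : R3) : Tan :=
  (-(3 * epsFun φ y)) • (Pi.single i 1, fun k => -σ k y (Pi.single i 1))

theorem basic_gammaForm_gammaVec (he : epsFun φ y ≠ 0) (i j : Fin 3) :
    basic (gammaForm φ i y) (gammaVec φ σ j y) = if i = j then 1 else 0 := by
  simp only [basic_apply, gammaForm, gammaVec, map_smul, smul_apply,
    ContinuousLinearMap.proj_apply, Pi.single_apply, smul_eq_mul]
  split_ifs
  · field_simp
  · simp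

/-- The torus component of `gammaVec` is the horizontal correction -σ, chosen so that the θ's
vanish. -/
theorem thetaForm_gammaVec (i j : Fin 3) : thetaForm σ i y (gammaVec φ σ j y) = 0 := by
  simp [thetaForm_apply, gammaVec, -neg_mul]

theorem basic_gammaForm_torus (i j : Fin 3) :
    basic (gammaForm φ i y) ((0, Pi.single j 1) : Tan) = 0 := by
  simp [basic_apply]

theorem thetaForm_torus (i j : Fin 3) :
    thetaForm σ i y ((0, Pi.single j 1) : Tan) = if i = j then 1 else 0 := by
  simp [thetaForm_apply, Pi.single_apply]

/-- The six covectors γⁱ, θⁱ form a coframe, so identities for J and positivity of g can be tested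
on them. -/
theorem eq_of_coframe (he : epsFun φ y ≠ 0) {u u' : Tan}
    (hγ : ∀ i, basic (gammaForm φ i y) u = basic (gammaForm φ i y) u')
    (hθ : ∀ i, thetaForm σ i y u = thetaForm σ i y u') : u = u' := by
  have h1 : u.1 = u'.1 := by
    ext i
    have := hγ i
    simpa [basic_apply, gammaForm, he] using this
  refine Prod.ext h1 (funext fun i => ?_)
  have := hθ i
  simpa [thetaForm_apply, h1] using this

/-- The almost complex structure with `γⁱ ∘ J = θⁱ` and `θⁱ ∘ J = -γⁱ`. -/
noncomputable def toricJ (φ : R3 → ℝ) (σ : Fin 3 → R3 → R3 →L[ℝ] ℝ) (y : R3) : Tan →L[ℝ] Tan :=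
  ∑ i, ((thetaForm σ i y).smulRight (gammaVec φ σ i y) -
    (basic (gammaForm φ i y)).smulRight ((0, Pi.single i 1) : Tan))

theorem basic_gammaForm_toricJ (he : epsFun φ y ≠ 0) (i : Fin 3) (u : Tan) :
    basic (gammaForm φ i y) (toricJ φ σ y u) = thetaForm σ i y u := by
  simp only [toricJ, sum_apply, sub_apply, ContinuousLinearMap.smulRight_apply, map_sum, map_sub,
    map_smul, basic_gammaForm_gammaVec he, basic_gammaForm_torus, smul_eq_mul]
  simp

theorem thetaForm_toricJ (i : Fin 3) (u : Tan) :
    thetaForm σ i y (toricJ φ σ y u) = -basic (gammaForm φ i y) u := by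
  simp only [toricJ, sum_apply, sub_apply, ContinuousLinearMap.smulRight_apply, map_sum, map_sub,
    map_smul, thetaForm_gammaVec, thetaForm_torus, smul_eq_mul]
  simp

/-- The metric `∑ Cᵢⱼ (θⁱ θʲ + γⁱ γʲ) + ∑ μᵢⱼ (γⁱ θʲ - θⁱ γʲ)`. -/
noncomputable def toricMetric (φ : R3 → ℝ) (σ : Fin 3 → R3 → R3 →L[ℝ] ℝ) (y : R3) :
    Tan →L[ℝ] Tan →L[ℝ] ℝ :=
  ∑ i, ∑ j, (hess φ y i j • ((thetaForm σ i y).smulRight (thetaForm σ j y) +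
      (basic (gammaForm φ i y)).smulRight (basic (gammaForm φ j y))) +
    muMatrix y i j • ((basic (gammaForm φ i y)).smulRight (thetaForm σ j y) -
      (thetaForm σ i y).smulRight (basic (gammaForm φ j y))))

theorem toricMetric_apply (u v : Tan) : toricMetric φ σ y u v =
    ∑ i, ∑ j, (hess φ y i j * (thetaForm σ i y u * thetaForm σ j y v +
        basic (gammaForm φ i y) u * basic (gammaForm φ j y) v) +
      muMatrix y i j * (basic (gammaForm φ i y) u * thetaForm σ j y v -
        thetaForm σ i y u * basic (gammaForm φ j y) v)) := by
  simp only [toricMetric, sum_apply, add_apply, sub_apply, smul_apply,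
    ContinuousLinearMap.smulRight_apply, smul_eq_mul]

/-- Identifies D as the matrix of g in the coframe (θ, γ); `toricMetric_pos` rests on this. -/
theorem toricMetric_self (u : Tan) : toricMetric φ σ y u u =
    Sum.elim (fun i => thetaForm σ i y u) (fun i => basic (gammaForm φ i y) u) ⬝ᵥ
      bigMatrix φ y *ᵥ Sum.elim (fun i => thetaForm σ i y u)
        (fun i => basic (gammaForm φ i y) u) := by
  simp [toricMetric_apply, bigMatrix, dotProduct, Matrix.mulVec,
    Fin.sum_univ_three]
  ring

theorem toricMetric_symm (hU : IsOpen U) (hφ : ContDiffOn ℝ ∞ φ U) (hy : y ∈ U) (u v : Tan) :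
    toricMetric φ σ y u v = toricMetric φ σ y v u := by
  have h := hess_symm hU hφ hy
  simp [toricMetric_apply, muMatrix, Fin.sum_univ_three, h 1 0, h 2 0, h 2 1]
  ring

/-- Composition with J replaces (θ, γ) by (-γ, θ): the C-blocks of D become ∑ θⁱ∧cⁱ, and the
μ-blocks become the terms yₖ (θⁱ∧θʲ + γⁱ∧γʲ). -/
theorem toricMetric_toricJ_left (hU : IsOpen U) (hφ : ContDiffOn ℝ ∞ φ U)
    (hy : y ∈ admissibleSet U φ) (u v : Tan) :
    toricMetric φ σ y (toricJ φ σ y u) v = fundForm y (fun i => thetaForm σ i y)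
      (fun i => basic (gammaForm φ i y)) (fun i => basic (cForm φ i y)) ![u, v] := by
  have h := hess_symm hU hφ hy.1
  have hc : ∀ i u, basic (cForm φ i y) u = ∑ j, hess φ y i j * basic (gammaForm φ j y) u :=
    fun i u => by simp [basic_apply, cForm]
  simp only [toricMetric_apply, fundForm_apply, basic_gammaForm_toricJ (epsFun_pos hy).ne',
    thetaForm_toricJ, hc, Fin.sum_univ_three, h 1 0, h 2 0, h 2 1]
  simp [muMatrix]
  ring

theorem toricMetric_torus (i j : Fin 3) :
    toricMetric φ σ y (0, Pi.single i 1) (0, Pi.single j 1) = hess φ y i j := by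
  simp [toricMetric_apply, basic_gammaForm_torus, thetaForm_torus]

theorem toricJ_toricJ (he : epsFun φ y ≠ 0) (u : Tan) :
    toricJ φ σ y (toricJ φ σ y u) = -u := by
  refine eq_of_coframe (σ := σ) he (fun i => ?_) fun i => ?_
  · rw [basic_gammaForm_toricJ he, thetaForm_toricJ, map_neg]
  · rw [thetaForm_toricJ, basic_gammaForm_toricJ he, map_neg]

theorem toricMetric_compatible (hy : y ∈ admissibleSet U φ) (u v : Tan) :
    toricMetric φ σ y (toricJ φ σ y u) (toricJ φ σ y v) = toricMetric φ σ y u v := by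
  simp only [toricMetric_apply, basic_gammaForm_toricJ (epsFun_pos hy).ne', thetaForm_toricJ]
  refine Finset.sum_congr rfl fun i _ => Finset.sum_congr rfl fun j _ => ?_
  ring

theorem toricMetric_pos (hy : y ∈ admissibleSet U φ) {u : Tan} (hu : u ≠ 0) :
    0 < toricMetric φ σ y u u := by
  rw [toricMetric_self]
  have h := hy.2.2.dotProduct_mulVec_pos (x := Sum.elim (fun i => thetaForm σ i y u)
    (fun i => basic (gammaForm φ i y) u)) fun h0 => hu <| by
      refine eq_of_coframe (σ := σ) (epsFun_pos hy).ne' (fun i => ?_) fun i => ?_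
      · rw [map_zero]; exact congrFun h0 (Sum.inr i)
      · rw [map_zero]; exact congrFun h0 (Sum.inl i)
  simpa using h

theorem contDiffOn_smulRight {V G : Type*} [NormedAddCommGroup V] [NormedSpace ℝ V]
    [NormedAddCommGroup G] [NormedSpace ℝ G] {a : R3 → V →L[ℝ] ℝ} {b : R3 → G}
    (ha : ContDiffOn ℝ ∞ a W) (hb : ContDiffOn ℝ ∞ b W) :
    ContDiffOn ℝ ∞ (fun y => (a y).smulRight (b y)) W :=
  (ContinuousLinearMap.smulRightL ℝ V G).isBoundedBilinearMap.contDiff.comp_contDiffOn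
    (ha.prodMk hb)

theorem contDiffOn_toricMetric (hU : IsOpen U) (hφ : ContDiffOn ℝ ∞ φ U)
    (hW : W ⊆ admissibleSet U φ) (hσ : IsPotential φ W σ) :
    ContDiffOn ℝ ∞ (toricMetric φ σ) W := by
  have hθ := contDiffOn_thetaForm hσ
  have hγ := fun i => ((contDiffOn_gammaForm hU hφ i).mono hW).basic
  have hC := fun i j => (contDiffOn_hess hU hφ i j).mono (hW.trans admissibleSet_subset)
  have hμ : ∀ i j, ContDiffOn ℝ ∞ (fun y => muMatrix y i j) W := by
    intro i j
    refine ContDiff.contDiffOn ?_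
    fin_cases i <;> fin_cases j <;> simp [muMatrix] <;> fun_prop
  refine ContDiffOn.sum fun i _ => ContDiffOn.sum fun j _ => ?_
  exact ((hC i j).smul ((contDiffOn_smulRight (hθ i) (hθ j)).add
    (contDiffOn_smulRight (hγ i) (hγ j)))).add ((hμ i j).smul
    ((contDiffOn_smulRight (hγ i) (hθ j)).sub (contDiffOn_smulRight (hθ i) (hγ j))))

theorem contDiffOn_toricJ (hU : IsOpen U) (hφ : ContDiffOn ℝ ∞ φ U)
    (hW : W ⊆ admissibleSet U φ) (hσ : IsPotential φ W σ) :
    ContDiffOn ℝ ∞ (toricJ φ σ) W := by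
  have hθ := contDiffOn_thetaForm hσ
  have hγ := fun i => ((contDiffOn_gammaForm hU hφ i).mono hW).basic
  have he := (contDiffOn_epsFun hU hφ).mono hW
  have hv : ∀ i, ContDiffOn ℝ ∞ (gammaVec φ σ i) W := fun i =>
    (contDiffOn_const.mul he).neg.smul (contDiffOn_const.prodMk
      (contDiffOn_pi.2 fun k => ((hσ k).1.clm_apply contDiffOn_const).neg))
  exact ContDiffOn.sum fun i _ => (contDiffOn_smulRight (hθ i) (hv i)).sub
    (contDiffOn_smulRight (hγ i) contDiffOn_const)

/-- The complex volume form on `W × T³`. -/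
noncomputable def toricPsi (φ : R3 → ℝ) (σ : Fin 3 → R3 → R3 →L[ℝ] ℝ) (y : R3) :
    Tan [⋀^Fin 3]→L[ℝ] ℂ :=
  holForm (epsFun φ y) (fun i => thetaForm σ i y) (fun i => basic (gammaForm φ i y))

theorem contDiffOn_toricPsi (hU : IsOpen U) (hφ : ContDiffOn ℝ ∞ φ U)
    (hW : W ⊆ admissibleSet U φ) (hσ : IsPotential φ W σ) :
    ContDiffOn ℝ ∞ (toricPsi φ σ) W := by
  have hz : ∀ i (u : Tan), ContDiffOn ℝ ∞ (fun y => zetaForm (fun i => thetaForm σ i y)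
      (fun i => basic (gammaForm φ i y)) i u) W := fun i u => by
    simp only [zetaForm_apply]
    exact (Complex.ofRealCLM.contDiff.comp_contDiffOn
      (((contDiffOn_gammaForm hU hφ i).mono hW).basic.clm_apply contDiffOn_const)).sub
      (contDiffOn_const.mul (Complex.ofRealCLM.contDiff.comp_contDiffOn
        ((contDiffOn_thetaForm hσ i).clm_apply contDiffOn_const)))
  refine contDiffOn_alternating_of_apply fun v => ?_
  simp only [toricPsi, holForm, ContinuousAlternatingMap.smul_apply, mulWedge_three]
  have hm := fun a b c : Fin 3 => ((hz 0 (v a)).mul (hz 1 (v b))).mul (hz 2 (v c))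
  exact ((contDiffOn_epsFun hU hφ).mono hW).smul ((((((hm _ _ _).sub (hm _ _ _)).sub
    (hm _ _ _)).add (hm _ _ _)).add (hm _ _ _)).sub (hm _ _ _))

/-- The fundamental `2`-form on `W × T³`. -/
noncomputable def toricFund (φ : R3 → ℝ) (σ : Fin 3 → R3 → R3 →L[ℝ] ℝ) (y : R3) :
    Tan [⋀^Fin 2]→L[ℝ] ℝ :=
  fundForm y (fun i => thetaForm σ i y) (fun i => basic (gammaForm φ i y))
    (fun i => basic (cForm φ i y))

theorem toricOmega_eq (q : R3 × Torus3) : toricOmega φ σ q = toricFund φ σ q.1 := rfl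

theorem contDiffOn_toricFund (hU : IsOpen U) (hφ : ContDiffOn ℝ ∞ φ U)
    (hW : W ⊆ admissibleSet U φ) (hσ : IsPotential φ W σ) :
    ContDiffOn ℝ ∞ (toricFund φ σ) W := by
  refine contDiffOn_alternating_of_apply fun v => ?_
  have h : ∀ y ∈ W, toricFund φ σ y v = toricMetric φ σ y (toricJ φ σ y (v 0)) (v 1) := by
    intro y hy
    rw [toricMetric_toricJ_left hU hφ (hW hy)]
    congr 1
    exact List.ofFn_inj.1 rfl
  exact (((contDiffOn_toricMetric hU hφ hW hσ).clm_apply ((contDiffOn_toricJ hU hφ hW hσ).clm_apply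
    contDiffOn_const)).clm_apply contDiffOn_const).congr h

/-- Both sides are multiples of θ¹²³∧γ¹²³, with coefficients 8i ε² and 8i (det C - yᵀCy). -/
theorem toricPsi_normalized (hU : IsOpen U) (hφ : ContDiffOn ℝ ∞ φ U) (hMA : SolvesMA U φ)
    (hy : y ∈ admissibleSet U φ) (v : Fin 6 → Tan) :
    wedge (toricPsi φ σ y).toAlternatingMap
        ((Complex.conjCLE : ℂ →L[ℝ] ℂ).compContinuousAlternatingMap
          (toricPsi φ σ y)).toAlternatingMap v =
      -8 * Complex.I *
        ((1 / 6 * wedge (wedge (toricFund φ σ y).toAlternatingMap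
          (toricFund φ σ y).toAlternatingMap) (toricFund φ σ y).toAlternatingMap v : ℝ) : ℂ) := by
  have h := wedge_cube_fundForm y (fun i => thetaForm σ i y) (fun i => basic (gammaForm φ i y))
    (fun i => basic (cForm φ i y)) (hess φ y) (fun i u => by simp [basic_apply, cForm]) v
  rw [toricPsi, wedge_holForm_conj, toricFund, h, epsFun_sq hU hφ hMA hy]
  push_cast
  ring

set_option maxRecDepth 8000 in
/-- The toric `SU(3)`-structure. -/
noncomputable def toricStructure (hU : IsOpen U) (hφ : ContDiffOn ℝ ∞ φ U) (hMA : SolvesMA U φ)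
    (hW : W ⊆ admissibleSet U φ) (hσ : IsPotential φ W σ) : SU3Structure W where
  g q := toricMetric φ σ q.1
  J q := toricJ φ σ q.1
  omega q := toricFund φ σ q.1
  psi q := toricPsi φ σ q.1
  g_smooth := smoothOver_of_base (contDiffOn_toricMetric hU hφ hW hσ)
  J_smooth := smoothOver_of_base (contDiffOn_toricJ hU hφ hW hσ)
  psi_smooth := smoothOver_of_base (contDiffOn_toricPsi hU hφ hW hσ)
  g_symm _ hq := toricMetric_symm hU hφ (hW hq).1
  g_pos _ hq _ hu := toricMetric_pos (hW hq) hu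
  J_sq _ hq := toricJ_toricJ (epsFun_pos (hW hq)).ne'
  J_compatible _ hq := toricMetric_compatible (hW hq)
  omega_eq _ hq u v := (toricMetric_toricJ_left hU hφ (hW hq) u v).symm
  psi_type q hq := holForm_map _ _ _ (toricJ φ σ q.1)
    (basic_gammaForm_toricJ (epsFun_pos (hW hq)).ne') thetaForm_toricJ
  psi_normalized q hq v := toricPsi_normalized (y := q.1) (σ := σ) hU hφ hMA (hW hq) v

variable (hU : IsOpen U) (hφ : ContDiffOn ℝ ∞ φ U) (hMA : SolvesMA U φ)
  (hW : W ⊆ admissibleSet U φ) (hσ : IsPotential φ W σ)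

theorem hasToricForms_toricStructure :
    HasToricForms φ σ (toricStructure hU hφ hMA hW hσ) :=
  fun _ _ => ⟨rfl, re_holForm _ _ _, im_holForm _ _ _⟩

theorem toricStructure_isStrictNK (hWo : IsOpen W) :
    (toricStructure hU hφ hMA hW hσ).IsStrictNK := by
  intro p hp
  have hb := (baseEquations hU hφ hMA (hW hp)).pullback
  have hθ := hasFDerivAt_thetaForm hWo hσ hp
  have hω : extDeriv (fun q : Tan => toricFund φ σ q.1) p = (3 : ℝ) • realVolForm (epsFun φ p.1)
      (fun i => thetaForm σ i p.1) (fun i => basic (gammaForm φ i p.1)) :=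
    hb.extDeriv_fundForm (θ := fun i q => thetaForm σ i q.1) hθ
  have hψ : ∀ v, extDeriv (fun q : Tan => imagVolForm (epsFun φ q.1) (fun i => thetaForm σ i q.1)
      (fun i => basic (gammaForm φ i q.1))) p v =
      -2 * wedge (toricFund φ σ p.1).toAlternatingMap (toricFund φ σ p.1).toAlternatingMap v :=
    hb.extDeriv_imagVolForm (θ := fun i q => thetaForm σ i q.1) hθ
  have hre : lift (toricStructure hU hφ hMA hW hσ).psiPlus p = realVolForm (epsFun φ p.1)
      (fun i => thetaForm σ i p.1) (fun i => basic (gammaForm φ i p.1)) := re_holForm _ _ _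
  have him : lift (toricStructure hU hφ hMA hW hσ).psiMinus = fun q => imagVolForm (epsFun φ q.1)
      (fun i => thetaForm σ i q.1) (fun i => basic (gammaForm φ i q.1)) :=
    funext fun q => im_holForm _ _ _
  refine ⟨?_, fun v => ?_⟩
  · rw [hre]
    exact hω
  · rw [him]
    exact hψ v

/-- Pointwise: ψ⁺ and ψ⁻ give ψ, the type condition on ψ gives J, and g(u, v) = -ω(Ju, v) gives g.
-/
theorem eq_toricStructure (hU : IsOpen U) (hφ : ContDiffOn ℝ ∞ φ U)
    (hW : W ⊆ admissibleSet U φ) {S : SU3Structure W} (hS : HasToricForms φ σ S) {q : R3 × Torus3}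
    (hq : q.1 ∈ W) : S.g q = toricMetric φ σ q.1 ∧ S.J q = toricJ φ σ q.1 := by
  obtain ⟨h1, h2, h3⟩ := hS q hq
  have he := (epsFun_pos (hW hq)).ne'
  have hψ : S.psi q = toricPsi φ σ q.1 := by
    ext v
    rw [toricPsi, holForm_apply]
    have e1 : (S.psi q v).re = realVolForm (epsFun φ q.1) (fun i => thetaForm σ i q.1)
      (fun i => basic (gammaForm φ i q.1)) v := DFunLike.congr_fun h2 v
    have e2 : (S.psi q v).im = imagVolForm (epsFun φ q.1) (fun i => thetaForm σ i q.1)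
      (fun i => basic (gammaForm φ i q.1)) v := DFunLike.congr_fun h3 v
    rw [← Complex.re_add_im (S.psi q v)]
    rw [e1, e2, mul_comm]
  have hJ : ∀ u, S.J q u = toricJ φ σ q.1 u := fun u => by
    have h := fun i => eq_of_holForm_map he (fun i => thetaForm σ i q.1)
      (fun i => basic (gammaForm φ i q.1)) (fun j => gammaVec φ σ j q.1)
      (basic_gammaForm_gammaVec he) thetaForm_gammaVec u (S.J q u) (fun v w => by
        have := S.psi_type q hq u v w
        rwa [hψ] at this) i
    refine eq_of_coframe (σ := σ) he (fun i => ?_) fun i => ?_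
    · rw [basic_gammaForm_toricJ he, (h i).1]
    · rw [thetaForm_toricJ, (h i).2]
  refine ⟨ContinuousLinearMap.ext fun u => ContinuousLinearMap.ext fun v => ?_,
    ContinuousLinearMap.ext hJ⟩
  have e1 := S.omega_eq q hq (S.J q u) v
  rw [S.J_sq q hq, h1, toricOmega_eq, toricFund, ← toricMetric_toricJ_left hU hφ (hW hq), hJ,
    toricJ_toricJ he] at e1
  simpa using e1.symm

theorem lift_torusField (i : Fin 3) :
    lift (torusField i) = fun _ => ((0, Pi.single i 1) : Tan) := rfl

theorem fderiv_lift_torusField (i : Fin 3) (p : Tan) : fderiv ℝ (lift (torusField i)) p = 0 := by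
  rw [lift_torusField]
  exact (hasFDerivAt_const _ _).fderiv

/-- ζᵢ has constant coefficients, so its derivative terms vanish, and α does not vary along the
torus directions. -/
theorem lieForm_torusField_eq_zero {k : ℕ} {α : R3 → Tan [⋀^Fin k]→L[ℝ] ℝ} (hWo : IsOpen W)
    (hα : ContDiffOn ℝ ∞ α W) {p : Tan} (hp : p.1 ∈ W) (i : Fin 3) (v : Fin k → Tan) :
    lieForm (lift (torusField i)) (lift fun q => α q.1) p v = 0 := by
  rw [lieForm, fderiv_lift_torusField]
  have h0 : ∀ j, α p.1 (Function.update v j 0) = 0 := fun j => (α p.1).map_coord_zero j (by simp)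
  have h := fderiv_lift_base hWo hα hp (Pi.single i 1)
  change fderiv ℝ (lift fun q => α q.1) p (0, Pi.single i 1) v + _ = 0
  rw [h]
  simp [lift, h0]

theorem isInfinitesimalAutomorphism_torusField (hWo : IsOpen W) (i : Fin 3) :
    (toricStructure hU hφ hMA hW hσ).IsInfinitesimalAutomorphism (torusField i) := by
  have hψ := contDiffOn_toricPsi hU hφ hW hσ
  refine ⟨contDiffOn_const, fun p hp => ⟨fun u v => ?_, fun u => ?_, fun v => ?_, fun v => ?_,
    fun v => ?_⟩⟩
  · have h := fderiv_lift_base hWo (contDiffOn_toricMetric hU hφ hW hσ) hp (Pi.single i 1)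
    rw [lieBilin, fderiv_lift_torusField]
    change fderiv ℝ (lift fun q => toricMetric φ σ q.1) p (0, Pi.single i 1) u v + _ + _ = 0
    simp [h]
  · have h := fderiv_lift_base hWo (contDiffOn_toricJ hU hφ hW hσ) hp (Pi.single i 1)
    rw [lieEndo, fderiv_lift_torusField]
    change fderiv ℝ (lift fun q => toricJ φ σ q.1) p (0, Pi.single i 1) u - _ + _ = 0
    simp [h]
  · exact lieForm_torusField_eq_zero hWo (contDiffOn_toricFund hU hφ hW hσ) hp i v
  · exact lieForm_torusField_eq_zero
      (α := fun y => Complex.reCLM.compContinuousAlternatingMap (toricPsi φ σ y)) hWo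
      (contDiffOn_alternating_of_apply fun v => Complex.reCLM.contDiff.comp_contDiffOn
        ((ContinuousAlternatingMap.apply ℝ Tan ℂ v).contDiff.comp_contDiffOn hψ)) hp i v
  · exact lieForm_torusField_eq_zero
      (α := fun y => Complex.imCLM.compContinuousAlternatingMap (toricPsi φ σ y)) hWo
      (contDiffOn_alternating_of_apply fun v => Complex.imCLM.contDiff.comp_contDiffOn
        ((ContinuousAlternatingMap.apply ℝ Tan ℂ v).contDiff.comp_contDiffOn hψ)) hp i v

theorem linearIndependent_torusField (q : R3 × Torus3) :
    LinearIndependent ℝ (fun i => torusField i q) := by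
  have h := (Pi.basisFun ℝ (Fin 3)).linearIndependent.map' (LinearMap.inr ℝ R3 R3)
    (LinearMap.ker_eq_bot.2 LinearMap.inr_injective)
  have e : (fun i => torusField i q) =
      LinearMap.inr ℝ R3 R3 ∘ fun i => Pi.basisFun ℝ (Fin 3) i := by
    ext1 i
    simp [torusField]
  rw [e]
  exact h

theorem lieBracket_torusField (i j : Fin 3) (p : Tan) :
    VectorField.lieBracket ℝ (lift (torusField i)) (lift (torusField j)) p = 0 := by
  simp [VectorField.lieBracket, fderiv_lift_torusField]

end ToricStructure

/-! ### Existence of potentials and independence of their choice. -/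

section Gauge

variable {U W : Set R3} {φ : R3 → ℝ} {σ σ' : Fin 3 → R3 → R3 →L[ℝ] ℝ}

theorem exists_isPotential (hU : IsOpen U) (hφ : ContDiffOn ℝ ∞ φ U) (hMA : SolvesMA U φ)
    (hW : W ⊆ admissibleSet U φ) (hH : SecondCohomologyVanishes W) :
    ∃ σ, IsPotential φ W σ := by
  have h := fun i => hH (fun y => (4 : ℝ) • tauForm φ i y)
    (((contDiffOn_tauForm hU hφ i).mono hW).const_smul 4) fun y hy => by
      change extDeriv ((4 : ℝ) • tauForm φ i) y = 0
      rw [extDeriv_smul, extDeriv_tauForm hU hφ hMA (hW hy), smul_zero]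
  choose σ hσ using h
  exact ⟨σ, hσ⟩

theorem Convex.secondCohomologyVanishes (hW : IsOpen W) (hc : Convex ℝ W) :
    SecondCohomologyVanishes W :=
  fun _ hβ hd => exists_primitive_of_closed_two_form hW hc hβ hd

/-- On a convex open set two potentials differ by an exact form. -/
theorem IsPotential.exists_gauge (hW : IsOpen W) (hc : Convex ℝ W) (hσ : IsPotential φ W σ)
    (hσ' : IsPotential φ W σ') : ∃ h : R3 → R3, ContDiffOn ℝ ∞ h W ∧
      ∀ y ∈ W, ∀ i u, DifferentiableAt ℝ h y ∧ σ i y u + fderiv ℝ h y u i = σ' i y u := by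
  have hd : ∀ i, ContDiffOn ℝ ∞ (fun y => σ' i y - σ i y) W := fun i => (hσ' i).1.sub (hσ i).1
  -- Both potentials have exterior derivative 4τᵢ, so σ'ᵢ - σᵢ is closed, hence exact on a convex
  -- set.
  have hex : ∀ i, ∃ f : R3 → ℝ, ∀ a ∈ W, HasFDerivAt f (σ' i a - σ i a) a := by
    refine fun i => hc.exists_forall_hasFDerivAt_of_fderiv_symmetric hW
      ((hd i).differentiableOn (by simp)) fun a ha u w => ?_
    have h1 := (((hσ i).1.contDiffAt (hW.mem_nhds ha)).differentiableAt (by simp)).hasFDerivAt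
    have h2 := (((hσ' i).1.contDiffAt (hW.mem_nhds ha)).differentiableAt (by simp)).hasFDerivAt
    have e1 := DFunLike.congr_fun ((hσ i).2 a ha) ![u, w]
    have e2 := DFunLike.congr_fun ((hσ' i).2 a ha) ![u, w]
    rw [extDeriv_oneForm_apply h1] at e1
    rw [extDeriv_oneForm_apply h2, ← e1] at e2
    rw [(h2.fun_sub h1).fderiv]
    simp at e2 ⊢
    linarith
  choose f hf using hex
  have hder : ∀ a ∈ W, HasFDerivAt (fun y i => f i y)
      (ContinuousLinearMap.pi fun i => σ' i a - σ i a) a := fun a ha =>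
    hasFDerivAt_pi.2 fun i => hf i a ha
  refine ⟨fun y i => f i y, contDiffOn_pi.2 fun i => ?_, fun y hy i u =>
    ⟨(hder y hy).differentiableAt, ?_⟩⟩
  -- The primitive is smooth because its derivative σ'ᵢ - σᵢ is.
  · rw [contDiffOn_infty_iff_fderiv_of_isOpen hW]
    exact ⟨fun a ha => (hf i a ha).differentiableAt.differentiableWithinAt,
      (hd i).congr fun a ha => (hf i a ha).fderiv⟩
  · rw [(hder y hy).fderiv]
    simp

theorem fundForm_compContinuousLinearMap (y : R3) (θ γ c : Fin 3 → Tan →L[ℝ] ℝ)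
    (A : Tan →L[ℝ] Tan) : (fundForm y θ γ c).compContinuousLinearMap A =
      fundForm y (fun i => (θ i).comp A) (fun i => (γ i).comp A) fun i => (c i).comp A := by
  ext v
  simp [fundForm, covectorWedge_two]

theorem realVolForm_compContinuousLinearMap (e : ℝ) (θ γ : Fin 3 → Tan →L[ℝ] ℝ)
    (A : Tan →L[ℝ] Tan) : (realVolForm e θ γ).compContinuousLinearMap A =
      realVolForm e (fun i => (θ i).comp A) fun i => (γ i).comp A := by
  ext v
  simp [realVolForm, covectorWedge_three]

theorem imagVolForm_compContinuousLinearMap (e : ℝ) (θ γ : Fin 3 → Tan →L[ℝ] ℝ)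
    (A : Tan →L[ℝ] Tan) : (imagVolForm e θ γ).compContinuousLinearMap A =
      imagVolForm e (fun i => (θ i).comp A) fun i => (γ i).comp A := by
  ext v
  simp [imagVolForm, covectorWedge_three]

theorem fderiv_gaugeLift_apply {h : R3 → R3} {p : Tan} (hh : DifferentiableAt ℝ h p.1) (u : Tan) :
    fderiv ℝ (gaugeLift h) p u = (u.1, u.2 + fderiv ℝ h p.1 u.1) := by
  have hd : HasFDerivAt (gaugeLift h) _ p := (hasFDerivAt_fst (𝕜 := ℝ)).prodMk
    ((hasFDerivAt_snd (𝕜 := ℝ)).add (hh.hasFDerivAt.comp p (hasFDerivAt_fst (𝕜 := ℝ))))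
  rw [hd.fderiv]
  rfl

theorem basic_comp_fderiv_gaugeLift {h : R3 → R3} {p : Tan} (hh : DifferentiableAt ℝ h p.1)
    (a : R3 →L[ℝ] ℝ) : (basic a).comp (fderiv ℝ (gaugeLift h) p) = basic a :=
  ContinuousLinearMap.ext fun u => by
    rw [ContinuousLinearMap.comp_apply, fderiv_gaugeLift_apply hh]
    rfl

/-- The shift by h pulls dxᵢ back to dxᵢ + dhᵢ, and dhᵢ is exactly the difference of the potentials.
-/
theorem thetaForm_comp_fderiv_gaugeLift {h : R3 → R3} {p : Tan} (hh : DifferentiableAt ℝ h p.1)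
    {i : Fin 3} (hi : ∀ u, σ i p.1 u + fderiv ℝ h p.1 u i = σ' i p.1 u) :
    (thetaForm σ i p.1).comp (fderiv ℝ (gaugeLift h) p) = thetaForm σ' i p.1 :=
  ContinuousLinearMap.ext fun u => by
    rw [ContinuousLinearMap.comp_apply, fderiv_gaugeLift_apply hh, thetaForm_apply,
      thetaForm_apply, ← hi]
    change u.2 i + fderiv ℝ h p.1 u.1 i + σ i p.1 u.1 = _
    ring

theorem IsPotential.exists_gaugePullsBack (hW : IsOpen W) (hc : Convex ℝ W)
    (hσ : IsPotential φ W σ) (hσ' : IsPotential φ W σ') :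
    ∃ h : R3 → R3, ContDiffOn ℝ ∞ h W ∧
      GaugePullsBack W h (toricOmega φ σ) (toricOmega φ σ') ∧
      GaugePullsBack W h (toricPsiPlus φ σ) (toricPsiPlus φ σ') ∧
      GaugePullsBack W h (toricPsiMinus φ σ) (toricPsiMinus φ σ') := by
  obtain ⟨h, hsm, hh⟩ := hσ.exists_gauge hW hc hσ'
  have hθ : ∀ p : Tan, p.1 ∈ W → ∀ i,
      (thetaForm σ i p.1).comp (fderiv ℝ (gaugeLift h) p) = thetaForm σ' i p.1 := fun p hp i =>
    thetaForm_comp_fderiv_gaugeLift (hh _ hp i 0).1 fun u => (hh _ hp i u).2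
  have hb : ∀ p : Tan, p.1 ∈ W → ∀ a,
      (basic a).comp (fderiv ℝ (gaugeLift h) p) = basic a := fun p hp =>
    basic_comp_fderiv_gaugeLift (hh _ hp 0 0).1
  refine ⟨h, hsm, fun p hp => ?_, fun p hp => ?_, fun p hp => ?_⟩
  · refine (fundForm_compContinuousLinearMap p.1 (fun i => thetaForm σ i p.1)
      (fun i => basic (gammaForm φ i p.1)) (fun i => basic (cForm φ i p.1)) _).trans ?_
    simp only [hθ p hp, hb p hp]
    rfl
  · refine (realVolForm_compContinuousLinearMap (epsFun φ p.1) (fun i => thetaForm σ i p.1)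
      (fun i => basic (gammaForm φ i p.1)) _).trans ?_
    simp only [hθ p hp, hb p hp]
    rfl
  · refine (imagVolForm_compContinuousLinearMap (epsFun φ p.1) (fun i => thetaForm σ i p.1)
      (fun i => basic (gammaForm φ i p.1)) _).trans ?_
    simp only [hθ p hp, hb p hp]
    rfl

end Gauge

/-! ### The theorem. -/

theorem mainTheorem2 (U : Set R3) (hU : IsOpen U) (φ : R3 → ℝ) (hφ : ContDiffOn ℝ ∞ φ U)
    (hMA : SolvesMA U φ) :
    IsOpen (admissibleSet U φ) ∧
    -- the forms `τᵢ` are smooth and closed on `U₀`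
    (∀ i, ContDiffOn ℝ ∞ (tauForm φ i) (admissibleSet U φ) ∧
      ∀ y ∈ admissibleSet U φ, extDeriv (tauForm φ i) y = 0) ∧
    -- potentials exist wherever the second cohomology vanishes, e.g. on convex open subsets
    (∀ W ⊆ admissibleSet U φ, IsOpen W → (Convex ℝ W ∨ SecondCohomologyVanishes W) →
      ∃ σ, IsPotential φ W σ) ∧
    -- on a convex open subset the structure does not depend on the choice of the potentials,
    -- up to a `T³`-equivariant diffeomorphism over the identity of `W`
    (∀ W ⊆ admissibleSet U φ, IsOpen W → Convex ℝ W →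
      ∀ σ σ', IsPotential φ W σ → IsPotential φ W σ' →
        ∃ h : R3 → R3, ContDiffOn ℝ ∞ h W ∧
          GaugePullsBack W h (toricOmega φ σ) (toricOmega φ σ') ∧
          GaugePullsBack W h (toricPsiPlus φ σ) (toricPsiPlus φ σ') ∧
          GaugePullsBack W h (toricPsiMinus φ σ) (toricPsiMinus φ σ')) ∧
    -- the nearly Kähler structure on `W × T³`
    (∀ W ⊆ admissibleSet U φ, IsOpen W → ∀ σ, IsPotential φ W σ →
      ∃ S : SU3Structure W, HasToricForms φ σ S ∧
        (∀ S' : SU3Structure W, HasToricForms φ σ S' →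
          ∀ q : R3 × Torus3, q.1 ∈ W → S'.g q = S.g q ∧ S'.J q = S.J q) ∧
        S.IsStrictNK ∧
        S.IsTorusInvariant ∧
        (∀ i, S.IsInfinitesimalAutomorphism (torusField i)) ∧
        (∀ q, LinearIndependent ℝ (fun i => torusField i q)) ∧
        (∀ i j p, VectorField.lieBracket ℝ (lift (torusField i)) (lift (torusField j)) p = 0) ∧
        (∀ q : R3 × Torus3, q.1 ∈ W → ∀ i j,
          S.g q (torusField i q) (torusField j q) = hess φ q.1 i j)) := by
  refine ⟨isOpen_admissibleSet hU hφ, fun i => ⟨contDiffOn_tauForm hU hφ i, fun y hy =>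
    extDeriv_tauForm hU hφ hMA hy i⟩, fun W hW hWo h => ?_, fun W _ hWo hc σ σ' hσ hσ' =>
    hσ.exists_gaugePullsBack hWo hc hσ', fun W hW hWo σ hσ => ?_⟩
  · exact exists_isPotential hU hφ hMA hW (h.elim (Convex.secondCohomologyVanishes hWo) id)
  · exact ⟨toricStructure hU hφ hMA hW hσ, hasToricForms_toricStructure hU hφ hMA hW hσ,
      fun S' hS' q hq => eq_toricStructure hU hφ hW hS' hq,
      toricStructure_isStrictNK hU hφ hMA hW hσ hWo,
      fun _ _ _ _ => ⟨rfl, rfl, rfl, rfl⟩,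
      isInfinitesimalAutomorphism_torusField hU hφ hMA hW hσ hWo,
      linearIndependent_torusField, lieBracket_torusField,
      fun q _ i j => toricMetric_torus i j⟩
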